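/- In a number-on-forehead (NOF) protocol for a function $f:X\times Y\times Z\to\{0,1\}$, on input $(x,y,z)$ Alice sees $(y,z)$, Bob sees $(x,z)$ and Charlie sees $(x,y)$; they write bits on a shared blackboard, where the transcript so far determines who writes next, each bit is a function of the transcript and of what its writer sees, and the final transcript determines the output. The cost is the maximal number of bits written. The deterministic NOF complexity of $f$ is the least cost of such a protocol that computes $f$. The randomized (public-coin) NOF complexity is the least cost when the protocol may depend on a uniformly random bit string known to all players and has to output $f(x,y,z)$ with probability at least $2/3$ on every input. The non-deterministic NOF complexity is the least cost when each player also has a private guess string (not charged to the cost), and $f(x,y,z)=1$ if and only if there are guesses for which the protocol outputs $1$. Theorem. There is an absolute constant $C$, and for every integer $k\ge 34$ there is a constant $c=c(k)>0$, such that the following holds for every prime power $q$. Let $N=q^k$ and let $D:(\mathbb{F}_q^k)^3\to\{0,1\}$ be the function $$D(x,y,z)=\mathbb{1}\big[\langle x,y\rangle=\langle x,z\rangle=\langle y,z\rangle\big],\qquad \langle x,y\rangle=\sum_{i=1}^k x_iy_i .$$ Then: 1. the randomized (public-coin) NOF communication complexity of $D$ is at most $C$; 2. the deterministic NOF communication complexity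 of $D$ and the non-deterministic NOF communication complexity of $D$ are both at least $c\,(\log_2 N)^{1/3}$. -/

import Mathlib

/-- A three-party blackboard protocol tree. `A`, `B`, `C` are the types of what Alice, Bob and
Charlie can see. At an inner node the player who is to speak (determined by the transcript so far)
writes one bit, which is a function of what that player sees, and the protocol continues in the
subtree `p₀` (if the bit is `false`) or `p₁` (if it is `true`). Leaves carry the output. -/
inductive Protocol (A B C : Type*) where
  | output (b : Bool) : Protocol A B C
  | alice (msg : A → Bool) (p₀ p₁ : Protocol A B C) : Protocol A B C
  | bob (msg : B → Bool) (p₀ p₁ : Protocol A B C) : Protocol A B C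
  | charlie (msg : C → Bool) (p₀ p₁ : Protocol A B C) : Protocol A B C

namespace Protocol

/-- The number of bits sent in the worst case: the depth of the tree. -/
def cost {A B C : Type*} : Protocol A B C → ℕ
  | output _ => 0
  | alice _ p₀ p₁ => max p₀.cost p₁.cost + 1
  | bob _ p₀ p₁ => max p₀.cost p₁.cost + 1
  | charlie _ p₀ p₁ => max p₀.cost p₁.cost + 1

/-- The output of the protocol when the players see `a`, `b`, `c`. -/
def run {A B C : Type*} : Protocol A B C → A → B → C → Bool
  | output v, _, _, _ => v
  | alice msg p₀ p₁, a, b, c => if msg a then p₁.run a b c else p₀.run a b c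
  | bob msg p₀ p₁, a, b, c => if msg b then p₁.run a b c else p₀.run a b c
  | charlie msg p₀ p₁, a, b, c => if msg c then p₁.run a b c else p₀.run a b c

end Protocol

/-- `f` has a deterministic number-on-forehead protocol that sends at most `n` bits: on the input
`(x, y, z)` Alice sees `(y, z)`, Bob sees `(x, z)` and Charlie sees `(x, y)`. -/
def HasDetNOF {X Y Z : Type*} (f : X → Y → Z → Bool) (n : ℕ) : Prop :=
  ∃ P : Protocol (Y × Z) (X × Z) (X × Y),
    P.cost ≤ n ∧ ∀ x y z, P.run (y, z) (x, z) (x, y) = f x y z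

/-- `f` has a randomized number-on-forehead protocol with public randomness that sends at most `n`
bits and errs with probability at most `1/3` on every input: a deterministic protocol `P r` for each
value of a public string `r`, which is uniformly distributed in `{0,1}^m`, for some length `m`. -/
def HasRandNOF {X Y Z : Type*} (f : X → Y → Z → Bool) (n : ℕ) : Prop :=
  ∃ (m : ℕ) (P : (Fin m → Bool) → Protocol (Y × Z) (X × Z) (X × Y)),
    (∀ r, (P r).cost ≤ n) ∧
    ∀ x y z,
      ((Finset.univ.filter fun r => (P r).run (y, z) (x, z) (x, y) ≠ f x y z).card : ℝ) / 2 ^ m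
        ≤ 1 / 3

/-- `f` has a non-deterministic number-on-forehead protocol that sends at most `n` bits: each player
in addition has a private guess, a bit string of some length `m`, and `f x y z` is true if and only
if some guesses lead to acceptance. Guesses are free of charge, but another player learns about
them only through the bits that are sent. -/
def HasNondetNOF {X Y Z : Type*} (f : X → Y → Z → Bool) (n : ℕ) : Prop :=
  ∃ (m : ℕ) (P : Protocol ((Y × Z) × (Fin m → Bool)) ((X × Z) × (Fin m → Bool))
      ((X × Y) × (Fin m → Bool))),
    P.cost ≤ n ∧
    ∀ x y z, f x y z = true ↔
      ∃ u v w : Fin m → Bool, P.run ((y, z), u) ((x, z), v) ((x, y), w) = true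

/-- Deterministic NOF communication complexity: the least number of bits (`⊤` if no protocol
computes `f`, which does not happen for finite `X`, `Y`, `Z`). -/
noncomputable def detNOF {X Y Z : Type*} (f : X → Y → Z → Bool) : ℕ∞ :=
  ⨅ (n : ℕ) (_ : HasDetNOF f n), (n : ℕ∞)

/-- Randomized (public-coin, error at most `1/3`) NOF communication complexity. -/
noncomputable def randNOF {X Y Z : Type*} (f : X → Y → Z → Bool) : ℕ∞ :=
  ⨅ (n : ℕ) (_ : HasRandNOF f n), (n : ℕ∞)

/-- Non-deterministic NOF communication complexity. -/
noncomputable def nondetNOF {X Y Z : Type*} (f : X → Y → Z → Bool) : ℕ∞ :=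
  ⨅ (n : ℕ) (_ : HasNondetNOF f n), (n : ℕ∞)

open Classical in
/-- The function `D(x, y, z) = 1[⟨x,y⟩ = ⟨x,z⟩ = ⟨y,z⟩]` on `(F^k)^3`, for the standard inner
product `⟨x,y⟩ = ∑ i, x i * y i`. -/
noncomputable def ipTriple (F : Type*) [Field F] (k : ℕ) (x y z : Fin k → F) : Bool :=
  decide (x ⬝ᵥ y = x ⬝ᵥ z ∧ x ⬝ᵥ z = y ⬝ᵥ z)

/-!
Randomized upper bound: the three inner products are each known to one player, so `ipTriple` is an
equality problem, which two random hash bits per field element decide with error `1 / 4`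
(`hasRandNOF_ipTriple`).

Lower bound: the accepting leaves of a nondeterministic protocol of cost `n` cover the support of
`ipTriple` by `2 ^ n` cylinder intersections (`HasNondetNOF.exists_cylinder_cover`), and one of them
has density at least `2 ^ (-d) * q ^ (-2)` with `d = n + 1`, because the support has density at least
`q ^ (-2) / 2` (`density_ipEq_ge`). `relative_density_lt` shows that this is impossible when `q ≥ 2 ^ (20000 d ^ 3)`.

The reason is a sparse form of triangle counting. Let `s` be the indicator of such a cylinder
intersection and choose a cube `A × B × C` on which `density ^ (R + 1) * volume` is maximal, for
`R` of order `d ^ 2` (`IsMaximalCube`). With `δ` the density relative to `q ^ (-2)`, maximality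
forbids a subcube of relative volume `2 ^ (-O(d ^ 2))` whose density is larger by a factor `9 / 8`,
and makes every slice of the cube have density at least `19 / 20 * δ`. The shadows
`f x y = q ^ 2 * 𝔼 z, s x y z`, and likewise `g x z` and `h y z`, have mean `δ`. They are bounded
by `2` outside a negligible set of pairs, by a second moment computation in `F ^ k`
(`card_heavy_pairs_le`). Since `s` is a cylinder intersection, `f * g * h ≤ 8 * s` after truncation,
so `𝔼 f g h` is at most `8 * δ / q ^ 2`, far below the expected `δ ^ 3`.

This deficit yields a density increment. Normalize `f` and `g` to have column averages `1`; then
`T = f ∘ g - 1` equals `(f - 1) ∘ (g - 1)` and is close to `-1` on average against the weight `h`.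
By Bernoulli's inequality the `p`-th moment of `T` is at least of order `δ` for an even `p` of order
`d`, and by Cauchy–Schwarz so is that of `(f - 1) ∘ (f - 1)` or `(g - 1) ∘ (g - 1)`. All moments of
such a self-correlation are nonnegative, so the binomial theorem makes the `2p`-th moment of
`f ∘ f = 1 + (f - 1) ∘ (f - 1)` exponentially large, and some ratio of consecutive moments is at
least `4 / 3`. Sampling the other points of that moment produces a rectangle of density
`2 ^ (-O(d ^ 2))` on which `f` has average at least `5 / 4` (`exists_rectangle_of_ratio`), which
contradicts maximality.
-/

open Finset
open scoped BigOperators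

/-! ### Solution counts of linear systems -/

section LinearCounts

variable {F : Type*} [Field F] {k : ℕ}

theorem linearIndependent_pair_of_forall_smul_ne {z x : Fin k → F} (hz : z ≠ 0)
    (hx : ∀ a : F, a • z ≠ x) : LinearIndependent F ![z, x] :=
  (LinearIndependent.pair_iff' hz).2 hx

theorem linearIndependent_triple_of_forall_smul_add_ne {z w x : Fin k → F}
    (hzw : LinearIndependent F ![z, w]) (hx : ∀ a b : F, a • z + b • w ≠ x) :
    LinearIndependent F ![x, z, w] := by
  rw [show ![x, z, w] = (Fin.cons x ![z, w] : Fin 3 → Fin k → F) from rfl,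
    linearIndependent_finCons]
  refine ⟨hzw, fun h => ?_⟩
  rw [Matrix.range_cons, Matrix.range_cons, Matrix.range_empty, Set.union_empty,
    Set.singleton_union, Submodule.mem_span_pair] at h
  obtain ⟨a, b, h⟩ := h
  exact hx a b h

/-- The support of `ipTriple`, as a proposition. -/
def IpEq (x y z : Fin k → F) : Prop := x ⬝ᵥ y = x ⬝ᵥ z ∧ x ⬝ᵥ z = y ⬝ᵥ z

instance [DecidableEq F] (x y z : Fin k → F) : Decidable (IpEq x y z) := by
  unfold IpEq
  infer_instance

theorem ipEq_iff {x y z : Fin k → F} : IpEq x y z ↔ x ⬝ᵥ y = x ⬝ᵥ z ∧ x ⬝ᵥ z = y ⬝ᵥ z := Iff.rfl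

theorem IpEq.swap_right {x y z : Fin k → F} (h : IpEq x y z) : IpEq x z y := by
  obtain ⟨h1, h2⟩ := h
  exact ⟨h1.symm, by rw [h1, h2, dotProduct_comm]⟩

theorem IpEq.swap_left {x y z : Fin k → F} (h : IpEq x y z) : IpEq y x z := by
  obtain ⟨h1, h2⟩ := h
  exact ⟨by rw [dotProduct_comm, h1, h2], h2.symm⟩

variable [Fintype F] [DecidableEq F]

/-- A system of `r` linear equations with linearly independent left-hand sides has exactly
`|F| ^ k / |F| ^ r` solutions in `F ^ k`. -/
theorem card_solutions_mul {r : ℕ} {v : Fin r → Fin k → F} (hv : LinearIndependent F v)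
    (c : Fin r → F) :
    (#{y : Fin k → F | ∀ i, v i ⬝ᵥ y = c i}) * Fintype.card F ^ r = Fintype.card F ^ k := by
  classical
  set φ : (Fin k → F) →ₗ[F] (Fin r → F) := (Matrix.of v).mulVecLin with hφ
  have hsurj : Function.Surjective φ := by
    rw [← LinearMap.range_eq_top]
    apply Submodule.eq_top_of_finrank_eq
    have h : (Matrix.of v).rank = Fintype.card (Fin r) := LinearIndependent.rank_matrix hv
    rw [Matrix.rank] at h
    rw [hφ, h]
    simp
  have hφa : ∀ y d, φ y = d ↔ ∀ i, v i ⬝ᵥ y = d i := fun y d => by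
    rw [funext_iff]; rfl
  have hfib : ∀ d : Fin r → F, #{y : Fin k → F | φ y = d} = #{y : Fin k → F | φ y = c} :=
    fun d => AddMonoidHom.card_fiber_eq_of_mem_range φ.toAddMonoidHom (hsurj d) (hsurj c)
  have hcard : #(univ : Finset (Fin k → F)) = ∑ d : Fin r → F, #{y : Fin k → F | φ y = d} :=
    card_eq_sum_card_fiberwise (fun _ _ => mem_univ _)
  rw [sum_congr rfl (fun d _ => hfib d), sum_const, smul_eq_mul] at hcard
  simp only [card_univ, Fintype.card_fun, Fintype.card_fin] at hcard
  simp_rw [← hφa]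
  rw [hcard, mul_comm]

theorem card_solutions {r : ℕ} {v : Fin r → Fin k → F} (hv : LinearIndependent F v)
    (c : Fin r → F) :
    (#{y : Fin k → F | ∀ i, v i ⬝ᵥ y = c i} : ℝ)
      = (Fintype.card F : ℝ) ^ k / (Fintype.card F : ℝ) ^ r := by
  have hq : (Fintype.card F : ℝ) ≠ 0 := by exact_mod_cast Fintype.card_ne_zero
  rw [eq_div_iff (pow_ne_zero _ hq)]
  exact_mod_cast card_solutions_mul hv c

theorem card_ipEq_of_linearIndependent_pair {x z : Fin k → F}
    (h : LinearIndependent F ![z, x]) :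
    (#{y : Fin k → F | IpEq x y z} : ℝ)
      = (Fintype.card F : ℝ) ^ k / (Fintype.card F : ℝ) ^ 2 := by
  rw [← card_solutions h ![x ⬝ᵥ z, x ⬝ᵥ z]]
  congr 2
  ext y
  simp only [mem_filter, mem_univ, true_and, Fin.forall_fin_two, Matrix.cons_val_zero,
    Matrix.cons_val_one, ipEq_iff]
  rw [dotProduct_comm z y]
  tauto

theorem card_ipEq_pair_ge (z : Fin k → F) (hz : z ≠ 0) :
    ((Fintype.card F : ℝ) ^ k - Fintype.card F) *
        ((Fintype.card F : ℝ) ^ k / (Fintype.card F : ℝ) ^ 2)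
      ≤ ∑ x : Fin k → F, (#{y : Fin k → F | IpEq x y z} : ℝ) := by
  classical
  set q : ℝ := ((Fintype.card F : ℕ) : ℝ) with hq
  set L : Finset (Fin k → F) := univ.image (fun a : F => a • z) with hL
  have hLc : (#L : ℝ) ≤ q := by
    rw [hq]; exact_mod_cast (card_image_le (s := univ) (f := fun a : F => a • z))
  have hcompl : q ^ k - q ≤ #(Lᶜ) := by
    rw [card_compl, Nat.cast_sub (card_le_univ _)]
    simp only [Fintype.card_fun, Fintype.card_fin, Nat.cast_pow]
    linarith
  calc (q ^ k - q) * (q ^ k / q ^ 2) ≤ #(Lᶜ) * (q ^ k / q ^ 2) := by gcongr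
    _ = ∑ x ∈ Lᶜ, (#{y : Fin k → F | IpEq x y z} : ℝ) := by
        rw [← nsmul_eq_mul, ← sum_const]
        refine sum_congr rfl fun x hx => ?_
        rw [card_ipEq_of_linearIndependent_pair]
        refine linearIndependent_pair_of_forall_smul_ne hz fun a ha => ?_
        exact (mem_compl.1 hx) (mem_image.2 ⟨a, mem_univ _, ha⟩)
    _ ≤ _ := sum_le_sum_of_subset_of_nonneg (subset_univ _) fun _ _ _ => by positivity

theorem card_ipEq_two_le {z w : Fin k → F} (h : LinearIndependent F ![z, w]) :
    ∑ x : Fin k → F, (#{y : Fin k → F | IpEq x y z ∧ IpEq x y w} : ℝ)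
      ≤ (Fintype.card F : ℝ) ^ k / Fintype.card F *
          ((Fintype.card F : ℝ) ^ k / (Fintype.card F : ℝ) ^ 3)
        + (Fintype.card F : ℝ) ^ 2 * (Fintype.card F : ℝ) ^ k := by
  classical
  set q : ℝ := ((Fintype.card F : ℕ) : ℝ) with hq
  set L : Finset (Fin k → F) :=
    (univ : Finset (F × F)).image (fun a => a.1 • z + a.2 • w) with hL
  have hLc : (#L : ℝ) ≤ q ^ 2 := by
    have := card_image_le (s := (univ : Finset (F × F))) (f := fun a => a.1 • z + a.2 • w)
    rw [card_univ, Fintype.card_prod] at this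
    rw [hq, sq]; exact_mod_cast this
  have hone : (#{x : Fin k → F | x ⬝ᵥ z = x ⬝ᵥ w} : ℝ) = q ^ k / q := by
    have hzw : LinearIndependent F ![z - w] := by
      refine LinearIndependent.of_subsingleton 0 ?_
      simp only [Matrix.cons_val_zero]
      intro h0
      have := LinearIndependent.pair_iff.1 h 1 (-1)
        (by rw [one_smul, neg_one_smul]; exact (sub_eq_add_neg z w).symm.trans h0)
      exact one_ne_zero this.1
    have := card_solutions hzw ![0]
    rw [pow_one] at this
    rw [← this]
    congr 2
    ext x
    simp only [mem_filter, mem_univ, true_and, Fin.forall_fin_one, Matrix.cons_val_zero]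
    rw [sub_dotProduct, sub_eq_zero, dotProduct_comm z, dotProduct_comm w]
  have hNtot : ∀ x : Fin k → F, (#{y : Fin k → F | IpEq x y z ∧ IpEq x y w} : ℝ) ≤ q ^ k := by
    intro x
    have := card_le_univ ({y : Fin k → F | IpEq x y z ∧ IpEq x y w} : Finset (Fin k → F))
    rw [Fintype.card_fun, Fintype.card_fin] at this
    rw [hq]; exact_mod_cast this
  have hpt : ∀ x : Fin k → F, (#{y : Fin k → F | IpEq x y z ∧ IpEq x y w} : ℝ)
      ≤ (if x ⬝ᵥ z = x ⬝ᵥ w then q ^ k / q ^ 3 else 0) + (if x ∈ L then q ^ k else 0) := by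
    intro x
    by_cases hxL : x ∈ L
    · rw [if_pos hxL]
      refine (hNtot x).trans (le_add_of_nonneg_left ?_)
      split_ifs <;> positivity
    · rw [if_neg hxL, add_zero]
      split_ifs with hx
      · have hind : LinearIndependent F ![x, z, w] := by
          refine linearIndependent_triple_of_forall_smul_add_ne h fun a b hab => hxL ?_
          exact mem_image.2 ⟨(a, b), mem_univ _, hab⟩
        rw [← card_solutions hind ![x ⬝ᵥ z, x ⬝ᵥ z, x ⬝ᵥ z]]
        refine Nat.cast_le.2 (card_le_card fun y hy => ?_)
        simp only [mem_filter, mem_univ, true_and, ipEq_iff] at hy ⊢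
        obtain ⟨⟨h1, h2⟩, h3, h4⟩ := hy
        intro i
        fin_cases i
        · exact h1
        · simp [dotProduct_comm z y, h2]
        · simp [dotProduct_comm w y, ← h4, hx]
      · rw [Nat.cast_nonpos, card_eq_zero, filter_eq_empty_iff]
        rintro y - ⟨⟨h1, -⟩, h3, -⟩
        exact hx (h1.symm.trans h3)
  calc _ ≤ ∑ x : Fin k → F, ((if x ⬝ᵥ z = x ⬝ᵥ w then q ^ k / q ^ 3 else 0)
          + (if x ∈ L then q ^ k else 0)) := sum_le_sum fun x _ => hpt x
    _ = q ^ k / q * (q ^ k / q ^ 3) + #L * q ^ k := by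
        rw [sum_add_distrib, ← sum_filter, ← sum_filter, sum_const, sum_const, nsmul_eq_mul,
          nsmul_eq_mul, hone, filter_mem_eq_inter, univ_inter]
    _ ≤ _ := by gcongr

theorem card_ipEq_two_le_trivial (z w : Fin k → F) :
    ∑ x : Fin k → F, (#{y : Fin k → F | IpEq x y z ∧ IpEq x y w} : ℝ)
      ≤ (Fintype.card F : ℝ) ^ k * (Fintype.card F : ℝ) ^ k := by
  have h : ∀ x ∈ (univ : Finset (Fin k → F)),
      (#{y : Fin k → F | IpEq x y z ∧ IpEq x y w} : ℝ) ≤ (Fintype.card F : ℝ) ^ k := by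
    intro x _
    have := card_le_univ ({y : Fin k → F | IpEq x y z ∧ IpEq x y w} : Finset (Fin k → F))
    rw [Fintype.card_fun, Fintype.card_fin] at this
    exact_mod_cast this
  refine (sum_le_card_nsmul _ _ _ h).trans (le_of_eq ?_)
  simp

/-- Dependent pairs in `Z × Z` are rare. -/
theorem card_dependent_pairs_le (Z : Finset (Fin k → F))
    [DecidablePred fun p : (Fin k → F) × (Fin k → F) => ¬ LinearIndependent F ![p.1, p.2]] :
    (#{p ∈ Z ×ˢ Z | ¬ LinearIndependent F ![p.1, p.2]} : ℝ)
      ≤ (Fintype.card F + 1) * #Z := by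
  classical
  have hsub : {p ∈ Z ×ˢ Z | ¬ LinearIndependent F ![p.1, p.2]}
      ⊆ Z.image (fun w => ((0 : Fin k → F), w)) ∪
        (Z ×ˢ (univ : Finset F)).image (fun p => (p.1, p.2 • p.1)) := by
    rintro ⟨z, w⟩ hp
    simp only [mem_filter, mem_product] at hp
    obtain ⟨⟨hz, hw⟩, hdep⟩ := hp
    by_cases h0 : z = 0
    · exact mem_union_left _ (mem_image.2 ⟨w, hw, by rw [h0]⟩)
    · rw [LinearIndependent.pair_iff' h0] at hdep
      push Not at hdep
      obtain ⟨a, ha⟩ := hdep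
      exact mem_union_right _ (mem_image.2 ⟨(z, a), by simp [hz], by simp [ha]⟩)
  have h := (card_le_card hsub).trans (card_union_le _ _)
  have h1 := card_image_le (s := Z) (f := fun w => ((0 : Fin k → F), w))
  have h2 := card_image_le (s := Z ×ˢ (univ : Finset F)) (f := fun p => (p.1, p.2 • p.1))
  rw [card_product, card_univ] at h2
  have h3 : #{p ∈ Z ×ˢ Z | ¬ LinearIndependent F ![p.1, p.2]} ≤ (Fintype.card F + 1) * #Z := by
    nlinarith
  exact_mod_cast h3

end LinearCounts

/-! ### Second moment of the codegrees -/

section Codegrees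

variable {F : Type*} [Field F] [Fintype F] {k : ℕ}

theorem two_le_card_field : (2 : ℝ) ≤ ((Fintype.card F : ℕ) : ℝ) := by
  have : 1 < Fintype.card F := Fintype.one_lt_card
  exact_mod_cast this

variable [DecidableEq F]

theorem sum_card_ipEq (Z : Finset (Fin k → F)) :
    ∑ x : Fin k → F, ∑ y : Fin k → F, (#{z ∈ Z | IpEq x y z} : ℝ)
      = ∑ z ∈ Z, ∑ x : Fin k → F, (#{y : Fin k → F | IpEq x y z} : ℝ) := by
  simp_rw [card_filter, Nat.cast_sum]
  rw [sum_comm (s := Z)]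
  exact sum_congr rfl fun x _ => sum_comm

theorem sum_card_ipEq_sq (Z : Finset (Fin k → F)) :
    ∑ x : Fin k → F, ∑ y : Fin k → F, (#{z ∈ Z | IpEq x y z} : ℝ) ^ 2
      = ∑ p ∈ Z ×ˢ Z, ∑ x : Fin k → F,
          (#{y : Fin k → F | IpEq x y p.1 ∧ IpEq x y p.2} : ℝ) := by
  have h : ∀ x y : Fin k → F, (#{z ∈ Z | IpEq x y z} : ℝ) ^ 2
      = ∑ p ∈ Z ×ˢ Z, if IpEq x y p.1 ∧ IpEq x y p.2 then (1 : ℝ) else 0 := by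
    intro x y
    rw [card_filter, Nat.cast_sum, sq, sum_mul_sum, ← sum_product']
    refine sum_congr rfl fun p _ => ?_
    by_cases h1 : IpEq x y p.1 <;> by_cases h2 : IpEq x y p.2 <;> simp [h1, h2]
  simp_rw [h, card_filter, Nat.cast_sum, Nat.cast_ite, Nat.cast_one, Nat.cast_zero]
  rw [sum_comm (s := Z ×ˢ Z)]
  exact sum_congr rfl fun x _ => sum_comm

theorem sum_card_ipEq_ge (hk : 1 ≤ k) (Z : Finset (Fin k → F)) :
    ((#Z : ℝ) - 1) * (((Fintype.card F : ℝ) ^ k - Fintype.card F) *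
        ((Fintype.card F : ℝ) ^ k / (Fintype.card F : ℝ) ^ 2))
      ≤ ∑ x : Fin k → F, ∑ y : Fin k → F, (#{z ∈ Z | IpEq x y z} : ℝ) := by
  classical
  have hq := two_le_card_field (F := F)
  set q : ℝ := ((Fintype.card F : ℕ) : ℝ) with hqdef
  have hqk : q ≤ q ^ k := le_self_pow₀ (by linarith) (by omega)
  rw [sum_card_ipEq]
  calc ((#Z : ℝ) - 1) * ((q ^ k - q) * (q ^ k / q ^ 2))
      ≤ #(Z.erase 0) * ((q ^ k - q) * (q ^ k / q ^ 2)) := by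
        have h : (#Z : ℝ) ≤ #(Z.erase 0) + 1 := by
          exact_mod_cast (tsub_le_iff_right.1 (pred_card_le_card_erase (s := Z) (a := 0)))
        have : 0 ≤ (q ^ k - q) * (q ^ k / q ^ 2) :=
          mul_nonneg (by linarith) (by positivity)
        gcongr
        linarith
    _ = ∑ z ∈ Z.erase 0, (q ^ k - q) * (q ^ k / q ^ 2) := by rw [sum_const, nsmul_eq_mul]
    _ ≤ ∑ z ∈ Z.erase 0, ∑ x : Fin k → F, (#{y : Fin k → F | IpEq x y z} : ℝ) :=
        sum_le_sum fun z hz => card_ipEq_pair_ge z (ne_of_mem_erase hz)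
    _ ≤ _ := sum_le_sum_of_subset_of_nonneg (erase_subset _ _) fun _ _ _ =>
        sum_nonneg fun _ _ => Nat.cast_nonneg _

theorem sum_card_ipEq_sq_le (Z : Finset (Fin k → F)) :
    ∑ x : Fin k → F, ∑ y : Fin k → F, (#{z ∈ Z | IpEq x y z} : ℝ) ^ 2
      ≤ (#Z : ℝ) ^ 2 * ((Fintype.card F : ℝ) ^ k / Fintype.card F *
          ((Fintype.card F : ℝ) ^ k / (Fintype.card F : ℝ) ^ 3)
        + (Fintype.card F : ℝ) ^ 2 * (Fintype.card F : ℝ) ^ k)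
        + (Fintype.card F + 1) * #Z * ((Fintype.card F : ℝ) ^ k * (Fintype.card F : ℝ) ^ k) := by
  classical
  rw [sum_card_ipEq_sq]
  set q : ℝ := ((Fintype.card F : ℕ) : ℝ) with hqdef
  set M := q ^ k / q * (q ^ k / q ^ 3) + q ^ 2 * q ^ k with hM
  rw [← sum_filter_add_sum_filter_not (Z ×ˢ Z) (fun p => LinearIndependent F ![p.1, p.2])]
  gcongr
  · refine (sum_le_card_nsmul _ _ M fun p hp => card_ipEq_two_le (mem_filter.1 hp).2).trans ?_
    rw [nsmul_eq_mul]
    gcongr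
    rw [sq]
    exact_mod_cast (card_filter_le _ _).trans (card_product Z Z).le
  · refine (sum_le_card_nsmul _ _ _ fun p hp => card_ipEq_two_le_trivial p.1 p.2).trans ?_
    rw [nsmul_eq_mul]
    gcongr
    exact card_dependent_pairs_le Z

/-- On average over `(x, y)`, the number of `z ∈ Z` with `IpEq x y z` is close to `|Z| / q ^ 2`
in mean square. -/
theorem variance_card_ipEq_le (hk : 1 ≤ k) (Z : Finset (Fin k → F))
    (hZ : (Fintype.card F : ℝ) ^ k ≤ Fintype.card F * #Z) :
    ∑ x : Fin k → F, ∑ y : Fin k → F,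
        ((#{z ∈ Z | IpEq x y z} : ℝ) - #Z / (Fintype.card F : ℝ) ^ 2) ^ 2
      ≤ 4 * (#Z : ℝ) ^ 2 * (Fintype.card F : ℝ) ^ k * (Fintype.card F : ℝ) ^ 2 := by
  have h1 := sum_card_ipEq_ge hk Z
  have h2 := sum_card_ipEq_sq_le Z
  have hq := two_le_card_field (F := F)
  set q : ℝ := ((Fintype.card F : ℕ) : ℝ) with hqdef
  set a : ℝ := ((#Z : ℕ) : ℝ) with ha
  set T1 := ∑ x : Fin k → F, ∑ y : Fin k → F, (#{z ∈ Z | IpEq x y z} : ℝ) with hT1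
  set T2 := ∑ x : Fin k → F, ∑ y : Fin k → F, (#{z ∈ Z | IpEq x y z} : ℝ) ^ 2 with hT2
  set N := q ^ k with hN
  have hexp : ∑ x : Fin k → F, ∑ y : Fin k → F, ((#{z ∈ Z | IpEq x y z} : ℝ) - a / q ^ 2) ^ 2
      = T2 - 2 * (a / q ^ 2) * T1 + N ^ 2 * (a / q ^ 2) ^ 2 := by
    have : ∀ x y : Fin k → F, ((#{z ∈ Z | IpEq x y z} : ℝ) - a / q ^ 2) ^ 2
        = (#{z ∈ Z | IpEq x y z} : ℝ) ^ 2 - 2 * (a / q ^ 2) * (#{z ∈ Z | IpEq x y z} : ℝ)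
          + (a / q ^ 2) ^ 2 := fun x y => by ring
    simp_rw [this, sum_add_distrib, sum_sub_distrib, ← mul_sum]
    rw [hT1, hT2, sum_const, sum_const, nsmul_eq_mul, nsmul_eq_mul, card_univ, Fintype.card_fun,
      Fintype.card_fin, Nat.cast_pow, hN]
    ring
  rw [hexp]
  have hq0 : 0 < q := by linarith
  have ha0 : 0 ≤ a := by positivity
  have hN0 : 0 < N := by positivity
  have h3 : 2 * (a / q ^ 2) * ((a - 1) * ((N - q) * (N / q ^ 2))) ≤ 2 * (a / q ^ 2) * T1 := by
    gcongr
  have h4 : a * N ^ 2 ≤ q * a ^ 2 * N := by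
    have := mul_le_mul_of_nonneg_left hZ (mul_nonneg ha0 hN0.le)
    linarith
  -- The main terms of the two moments cancel; what remains is of lower order.
  have h5 : a ^ 2 * (N / q * (N / q ^ 3) + q ^ 2 * N) + (q + 1) * a * (N * N)
      - 2 * (a / q ^ 2) * ((a - 1) * ((N - q) * (N / q ^ 2))) + N ^ 2 * (a / q ^ 2) ^ 2
      = a ^ 2 * N * q ^ 2 + (q + 1) * (a * N ^ 2)
        + (2 * a ^ 2 * N * q + 2 * (a * N ^ 2) - 2 * a * N * q) / q ^ 4 := by
    field_simp
    ring
  have h6 : (2 * a ^ 2 * N * q + 2 * (a * N ^ 2) - 2 * a * N * q) / q ^ 4 ≤ a ^ 2 * N := by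
    rw [div_le_iff₀ (by positivity)]
    have h7 : 4 * q ≤ q ^ 4 := by nlinarith [pow_le_pow_left₀ (by norm_num) hq 3]
    have h8 : a ^ 2 * N * (4 * q) ≤ a ^ 2 * N * q ^ 4 := by gcongr
    have : 0 ≤ a * N * q := by positivity
    linarith
  have h9 : (q + 1) * (a * N ^ 2) ≤ (q + 1) * (q * a ^ 2 * N) := by gcongr
  have h10 : q + 1 ≤ 2 * q ^ 2 := by nlinarith
  have h11 : a ^ 2 * N * (q + 1) ≤ a ^ 2 * N * (2 * q ^ 2) := by gcongr
  linarith

/-- Few pairs have a codegree into `Z` that exceeds twice its typical value `|Z| / q ^ 2`. -/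
theorem card_heavy_pairs_le (hk : 34 ≤ k) (Z : Finset (Fin k → F))
    (hZ : (Fintype.card F : ℝ) ^ k ≤ Fintype.card F * #Z) :
    (#{p : (Fin k → F) × (Fin k → F) |
        2 * (#Z : ℝ) < (Fintype.card F : ℝ) ^ 2 * #{z ∈ Z | IpEq p.1 p.2 z}} : ℝ)
        * (Fintype.card F : ℝ) ^ 20 ≤ ((Fintype.card F : ℝ) ^ k) ^ 2 := by
  have h1 := variance_card_ipEq_le (by omega) Z hZ
  have hq := two_le_card_field (F := F)
  set q : ℝ := ((Fintype.card F : ℕ) : ℝ) with hqdef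
  set a : ℝ := ((#Z : ℕ) : ℝ) with ha
  set B : Finset ((Fin k → F) × (Fin k → F)) :=
    {p | 2 * a < q ^ 2 * #{z ∈ Z | IpEq p.1 p.2 z}} with hB
  have hq0 : 0 < q := by linarith
  have ha0 : 0 < a := by
    have : 0 < q * a := lt_of_lt_of_le (by positivity) hZ
    exact pos_of_mul_pos_right this hq0.le
  have h2 : (#B : ℝ) * (a / q ^ 2) ^ 2 ≤ 4 * a ^ 2 * q ^ k * q ^ 2 := by
    refine le_trans ?_ h1
    rw [← sum_product', ← nsmul_eq_mul]
    refine le_trans (card_nsmul_le_sum B _ _ fun p hp => ?_)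
      (sum_le_sum_of_subset_of_nonneg (subset_univ _) fun _ _ _ => sq_nonneg _)
    have hp' := (mem_filter.1 hp).2
    have h3 : 2 * (a / q ^ 2) < #{z ∈ Z | IpEq p.1 p.2 z} := by
      rw [← mul_div_assoc, div_lt_iff₀ (by positivity)]
      linarith
    have : 0 < a / q ^ 2 := by positivity
    exact pow_le_pow_left₀ this.le (by linarith) 2
  have h4 : (#B : ℝ) ≤ 4 * q ^ 6 * q ^ k := by
    have h5 : (#B : ℝ) * (a / q ^ 2) ^ 2 ≤ (4 * q ^ 6 * q ^ k) * (a / q ^ 2) ^ 2 := by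
      refine h2.trans (le_of_eq ?_)
      field_simp
    exact le_of_mul_le_mul_right h5 (by positivity)
  have h6 : q ^ 34 ≤ q ^ k := pow_le_pow_right₀ (by linarith) hk
  have h7 : (4 : ℝ) ≤ q ^ 8 := by
    calc (4 : ℝ) ≤ 2 ^ 8 := by norm_num
      _ ≤ q ^ 8 := by gcongr
  calc (#B : ℝ) * q ^ 20 ≤ (4 * q ^ 6 * q ^ k) * q ^ 20 := by gcongr
    _ ≤ (q ^ 8 * q ^ 6 * q ^ k) * q ^ 20 := by gcongr
    _ = q ^ 34 * q ^ k := by ring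
    _ ≤ q ^ k * q ^ k := by gcongr
    _ = _ := by ring

/-- The support of `ipTriple` has density at least `1 / (2 q ^ 2)`. -/
theorem density_ipEq_ge (hk : 34 ≤ k) :
    ((Fintype.card F : ℝ) ^ k) ^ 3 / (2 * (Fintype.card F : ℝ) ^ 2)
      ≤ ∑ x : Fin k → F, ∑ y : Fin k → F, (#{z : Fin k → F | IpEq x y z} : ℝ) := by
  refine le_trans ?_ (sum_card_ipEq_ge (by omega) univ)
  have hq := two_le_card_field (F := F)
  rw [card_univ, Fintype.card_fun, Fintype.card_fin, Nat.cast_pow]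
  set q : ℝ := ((Fintype.card F : ℕ) : ℝ) with hqdef
  have h1 : q ^ 4 ≤ q ^ k := pow_le_pow_right₀ (by linarith) (by omega)
  have h2 : 4 * q ≤ q ^ 4 := by nlinarith [pow_le_pow_left₀ (by norm_num) hq 3]
  set N := q ^ k with hN
  have hN0 : 0 < N := by positivity
  rw [div_le_iff₀ (by positivity)]
  have h3 : (N - 1) * ((N - q) * (N / q ^ 2)) * (2 * q ^ 2) = 2 * ((N - 1) * (N - q)) * N := by
    field_simp
  rw [h3]
  have h4 : N ^ 2 ≤ 2 * ((N - 1) * (N - q)) := by nlinarith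
  nlinarith

end Codegrees

/-! ### Moments of correlation kernels and sifting -/

section Sifting

variable {X Y Z : Type*}

/-- The correlation kernel `(f ∘ g)(y, z) = 𝔼 x ∈ A, f x y * g x z`. -/
noncomputable def corr (A : Finset X) (f : X → Y → ℝ) (g : X → Z → ℝ) (y : Y) (z : Z) : ℝ :=
  𝔼 x ∈ A, f x y * g x z

theorem expect_corr_pow (A : Finset X) (B : Finset Y) (C : Finset Z) (f : X → Y → ℝ)
    (g : X → Z → ℝ) (p : ℕ) :
    𝔼 y ∈ B, 𝔼 z ∈ C, corr A f g y z ^ p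
      = 𝔼 t ∈ Fintype.piFinset fun _ : Fin p => A,
          (𝔼 y ∈ B, ∏ i, f (t i) y) * 𝔼 z ∈ C, ∏ i, g (t i) z := by
  simp_rw [corr, expect_pow, prod_mul_distrib]
  rw [expect_congr rfl fun y _ => expect_comm _ _ _, expect_comm]
  simp_rw [expect_mul_expect]

theorem expect_corr_self_pow (A : Finset X) (B : Finset Y) (f : X → Y → ℝ) (p : ℕ) :
    𝔼 y ∈ B, 𝔼 y' ∈ B, corr A f f y y' ^ p
      = 𝔼 t ∈ Fintype.piFinset fun _ : Fin p => A, (𝔼 y ∈ B, ∏ i, f (t i) y) ^ 2 := by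
  simp_rw [expect_corr_pow, sq]

/-- All moments of a self-correlation are nonnegative. -/
theorem expect_corr_self_pow_nonneg (A : Finset X) (B : Finset Y) (f : X → Y → ℝ) (p : ℕ) :
    0 ≤ 𝔼 y ∈ B, 𝔼 y' ∈ B, corr A f f y y' ^ p := by
  rw [expect_corr_self_pow]
  exact expect_nonneg fun _ _ => sq_nonneg _

theorem expect_corr_pow_sq_le (A : Finset X) (B : Finset Y) (C : Finset Z) (f : X → Y → ℝ)
    (g : X → Z → ℝ) (p : ℕ) :
    (𝔼 y ∈ B, 𝔼 z ∈ C, corr A f g y z ^ p) ^ 2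
      ≤ (𝔼 y ∈ B, 𝔼 y' ∈ B, corr A f f y y' ^ p) *
        𝔼 z ∈ C, 𝔼 z' ∈ C, corr A g g z z' ^ p := by
  rw [expect_corr_pow, expect_corr_self_pow, expect_corr_self_pow]
  exact expect_mul_sq_le_sq_mul_sq _ _ _

theorem corr_eq_one_add {A : Finset X} (hA : A.Nonempty) {f : X → Y → ℝ} {g : X → Z → ℝ} {y : Y}
    {z : Z} (hf : 𝔼 x ∈ A, f x y = 1) (hg : 𝔼 x ∈ A, g x z = 1) :
    corr A f g y z = 1 + corr A (fun x y => f x y - 1) (fun x z => g x z - 1) y z := by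
  have h : corr A (fun x y => f x y - 1) (fun x z => g x z - 1) y z
      = 𝔼 x ∈ A, (f x y * g x z - f x y - g x z + 1) :=
    expect_congr rfl fun x _ => by ring
  rw [h, expect_add_distrib, expect_sub_distrib, expect_sub_distrib, hf, hg, expect_const hA, corr]
  ring

/-- Passing from the centred kernel to the kernel itself: all binomial terms are nonnegative, so
each of them is a lower bound. -/
theorem choose_mul_le_expect_corr_pow {A : Finset X} (hA : A.Nonempty) {B : Finset Y}
    {f : X → Y → ℝ} (hf : ∀ y ∈ B, 𝔼 x ∈ A, f x y = 1) {p m : ℕ} (hp : p ≤ m) :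
    (m.choose p : ℝ) * 𝔼 y ∈ B, 𝔼 y' ∈ B,
        corr A (fun x y => f x y - 1) (fun x y => f x y - 1) y y' ^ p
      ≤ 𝔼 y ∈ B, 𝔼 y' ∈ B, corr A f f y y' ^ m := by
  set K := corr A (fun x y => f x y - 1) (fun x y => f x y - 1) with hK
  have h : 𝔼 y ∈ B, 𝔼 y' ∈ B, corr A f f y y' ^ m
      = ∑ j ∈ range (m + 1), (m.choose j : ℝ) * 𝔼 y ∈ B, 𝔼 y' ∈ B, K y y' ^ j := by
    have h1 : ∀ y ∈ B, ∀ y' ∈ B, corr A f f y y' ^ m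
        = ∑ j ∈ range (m + 1), (m.choose j : ℝ) * K y y' ^ j := fun y hy y' hy' => by
      rw [corr_eq_one_add hA (hf y hy) (hf y' hy'), add_comm, add_pow]
      exact sum_congr rfl fun j _ => by rw [one_pow]; ring
    rw [expect_congr rfl fun y hy => expect_congr rfl fun y' hy' => h1 y hy y' hy']
    simp_rw [expect_sum_comm, mul_expect]
  rw [h]
  exact single_le_sum (f := fun j => (m.choose j : ℝ) * 𝔼 y ∈ B, 𝔼 y' ∈ B, K y y' ^ j)
    (fun j _ => mul_nonneg (by positivity) (expect_corr_self_pow_nonneg A B _ j))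
    (mem_range.2 (by omega))

/-- A rapidly growing sequence of moments has a large ratio of consecutive terms. -/
theorem exists_ratio_ge {N : ℕ → ℝ} (h0 : N 0 = 1) {p : ℕ} (hp : 1 ≤ p)
    (h : 2 ^ p ≤ N (2 * p)) : ∃ j < 2 * p, 4 / 3 * N j ≤ N (j + 1) := by
  by_contra! hcon
  have key : ∀ j ≤ 2 * p, N j ≤ (4 / 3) ^ j := by
    intro j
    induction j with
    | zero => intro _; simp [h0]
    | succ j ih =>
      intro hj
      have := hcon j (by omega)
      have := ih (by omega)
      rw [pow_succ]
      linarith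
  have h1 := h.trans (key _ le_rfl)
  rw [pow_mul] at h1
  exact absurd h1 (not_le.2 (pow_lt_pow_left₀ (by norm_num) (by norm_num) (by omega)))

/-- A bilinear form on weights in `[0, a] × [0, b]` is at most `a * b` times its value on a suitable
pair of sets. -/
theorem exists_sets_of_weights (A : Finset X) (B : Finset Y) (φ : X → Y → ℝ) {u : Y → ℝ}
    {v : X → ℝ} {a b : ℝ} (hv0 : ∀ x ∈ A, 0 ≤ v x) (hv : ∀ x ∈ A, v x ≤ a)
    (hu0 : ∀ y ∈ B, 0 ≤ u y) (hu : ∀ y ∈ B, u y ≤ b) (ha : 0 ≤ a) :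
    ∃ U ⊆ A, ∃ W ⊆ B,
      ∑ x ∈ A, ∑ y ∈ B, φ x y * u y * v x ≤ a * b * ∑ x ∈ U, ∑ y ∈ W, φ x y := by
  classical
  set U := {x ∈ A | 0 ≤ ∑ y ∈ B, φ x y * u y} with hU
  set W := {y ∈ B | 0 ≤ ∑ x ∈ U, φ x y} with hW
  refine ⟨U, filter_subset _ _, W, filter_subset _ _, ?_⟩
  calc ∑ x ∈ A, ∑ y ∈ B, φ x y * u y * v x
      ≤ ∑ x ∈ A, if 0 ≤ ∑ y ∈ B, φ x y * u y then a * ∑ y ∈ B, φ x y * u y else 0 := by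
        refine sum_le_sum fun x hx => ?_
        rw [← sum_mul]
        split_ifs with h
        · rw [mul_comm]
          exact mul_le_mul_of_nonneg_right (hv x hx) h
        · exact mul_nonpos_of_nonpos_of_nonneg (not_le.1 h).le (hv0 x hx)
    _ = a * ∑ y ∈ B, (∑ x ∈ U, φ x y) * u y := by
        rw [← sum_filter, ← mul_sum, sum_comm]
        simp_rw [sum_mul, hU]
    _ ≤ a * ∑ y ∈ B, if 0 ≤ ∑ x ∈ U, φ x y then b * ∑ x ∈ U, φ x y else 0 := by
        refine mul_le_mul_of_nonneg_left (sum_le_sum fun y hy => ?_) ha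
        split_ifs with h
        · rw [mul_comm]
          exact mul_le_mul_of_nonneg_right (hu y hy) h
        · exact mul_nonpos_of_nonpos_of_nonneg (not_le.1 h).le (hu0 y hy)
    _ = a * b * ∑ x ∈ U, ∑ y ∈ W, φ x y := by
        rw [← sum_filter, ← mul_sum, sum_comm, mul_assoc]

/-- Sifting: if the moments of the self-correlation of `f` grow by a factor `4 / 3` at some point,
then `f` has density at least `5 / 4` on a rectangle that is not too small. -/
theorem exists_rectangle_of_ratio {A : Finset X} (hA : A.Nonempty) {B : Finset Y}
    (hB : B.Nonempty) {f : X → Y → ℝ} {L : ℝ} (hL : 0 < L)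
    (hf0 : ∀ x ∈ A, ∀ y ∈ B, 0 ≤ f x y) (hfL : ∀ x ∈ A, ∀ y ∈ B, f x y ≤ L)
    (hf : ∀ y ∈ B, 𝔼 x ∈ A, f x y = 1) {j : ℕ}
    (h : 4 / 3 * 𝔼 y ∈ B, 𝔼 y' ∈ B, corr A f f y y' ^ j
      ≤ 𝔼 y ∈ B, 𝔼 y' ∈ B, corr A f f y y' ^ (j + 1)) :
    ∃ U ⊆ A, ∃ W ⊆ B,
      (#A : ℝ) * #B ≤ 12 * L ^ (2 * j + 1) * ∑ x ∈ U, ∑ y ∈ W, (f x y - 5 / 4) := by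
  have hA0 : (0 : ℝ) < #A := by exact_mod_cast hA.card_pos
  have hB0 : (0 : ℝ) < #B := by exact_mod_cast hB.card_pos
  set S := Fintype.piFinset fun _ : Fin j => A with hS
  have hSne : S.Nonempty := by rw [hS, Fintype.piFinset_nonempty]; exact fun _ => hA
  have hmem : ∀ t ∈ S, ∀ i, t i ∈ A := fun t ht i => Fintype.mem_piFinset.1 ht i
  set w : (Fin j → X) → Y → ℝ := fun t y => ∏ i, f (t i) y with hw
  have hw0 : ∀ t ∈ S, ∀ y ∈ B, 0 ≤ w t y := fun t ht y hy =>
    prod_nonneg fun i _ => hf0 _ (hmem t ht i) y hy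
  have hwL : ∀ t ∈ S, ∀ y ∈ B, w t y ≤ L ^ j := fun t ht y hy => by
    refine (prod_le_prod (fun i _ => hf0 _ (hmem t ht i) y hy)
      fun i _ => hfL _ (hmem t ht i) y hy).trans (by simp)
  have hN1 : 1 ≤ 𝔼 y ∈ B, 𝔼 y' ∈ B, corr A f f y y' ^ j := by
    have := choose_mul_le_expect_corr_pow hA hf (Nat.zero_le j)
    simpa [expect_const hB] using this
  -- The bracket whose weighted average over `(t, y')` is the difference of the two moments.
  set Q : (Fin j → X) → Y → ℝ := fun t y' =>
    𝔼 y ∈ B, 𝔼 x ∈ A, (f x y - 5 / 4) * w t y * f x y' with hQ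
  have hdiff : 𝔼 t ∈ S, 𝔼 y' ∈ B, w t y' * Q t y'
      = (𝔼 y ∈ B, 𝔼 y' ∈ B, corr A f f y y' ^ (j + 1))
        - 5 / 4 * 𝔼 y ∈ B, 𝔼 y' ∈ B, corr A f f y y' ^ j := by
    have hQ' : ∀ t, ∀ y' ∈ B, Q t y' = 𝔼 y ∈ B, w t y * (corr A f f y y' - 5 / 4) := by
      intro t y' hy'
      refine expect_congr rfl fun y _ => ?_
      rw [corr, mul_sub, mul_expect]
      have : w t y * (5 / 4) = 𝔼 x ∈ A, 5 / 4 * w t y * f x y' := by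
        rw [← mul_expect, hf y' hy']; ring
      rw [this, ← expect_sub_distrib]
      exact expect_congr rfl fun x _ => by ring
    have hw2 : ∀ y y', corr A f f y y' ^ j = 𝔼 t ∈ S, w t y * w t y' := by
      intro y y'
      rw [corr, expect_pow]
      simp_rw [prod_mul_distrib, hw, hS]
    have hR : (𝔼 y ∈ B, 𝔼 y' ∈ B, corr A f f y y' ^ (j + 1))
        - 5 / 4 * 𝔼 y ∈ B, 𝔼 y' ∈ B, corr A f f y y' ^ j
        = 𝔼 y ∈ B, 𝔼 y' ∈ B, 𝔼 t ∈ S, w t y' * (w t y * (corr A f f y y' - 5 / 4)) := by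
      rw [mul_expect, ← expect_sub_distrib]
      refine expect_congr rfl fun y _ => ?_
      rw [mul_expect, ← expect_sub_distrib]
      refine expect_congr rfl fun y' _ => ?_
      have : 𝔼 t ∈ S, w t y' * (w t y * (corr A f f y y' - 5 / 4))
          = corr A f f y y' ^ j * (corr A f f y y' - 5 / 4) := by
        rw [hw2, expect_mul]
        exact expect_congr rfl fun t _ => by ring
      rw [this]
      ring
    rw [hR, expect_congr rfl fun t _ => expect_congr rfl fun y' hy' => by rw [hQ' t y' hy'],
      expect_comm B B, expect_comm S B]
    refine expect_congr rfl fun y' _ => ?_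
    rw [expect_comm B S]
    exact expect_congr rfl fun t _ => mul_expect _ _ _
  have hpos : 1 / 12 ≤ 𝔼 t ∈ S, 𝔼 y' ∈ B, w t y' * Q t y' := by rw [hdiff]; linarith
  obtain ⟨t, ht, h1⟩ := exists_le_of_le_expect hSne hpos
  obtain ⟨y', hy', h2⟩ := exists_le_of_le_expect hB h1
  have hQ1 : 1 / 12 ≤ L ^ j * Q t y' := by
    have hQ0 : 0 ≤ Q t y' := by
      by_contra! hneg
      have := mul_nonpos_of_nonneg_of_nonpos (hw0 t ht y' hy') hneg.le
      linarith
    exact h2.trans (mul_le_mul_of_nonneg_right (hwL t ht y' hy') hQ0)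
  obtain ⟨U, hU, W, hW, h3⟩ := exists_sets_of_weights A B (fun x y => f x y - 5 / 4)
    (u := w t) (v := fun x => f x y') (a := L) (b := L ^ j)
    (fun x hx => hf0 x hx y' hy') (fun x hx => hfL x hx y' hy') (hw0 t ht) (hwL t ht) hL.le
  refine ⟨U, hU, W, hW, ?_⟩
  have hQs : Q t y' = (∑ x ∈ A, ∑ y ∈ B, (f x y - 5 / 4) * w t y * f x y') / (#A * #B) := by
    rw [hQ]
    simp only
    rw [expect_comm, expect_eq_sum_div_card, sum_congr rfl fun x _ => expect_eq_sum_div_card _ _,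
      ← sum_div, div_div, mul_comm (#B : ℝ)]
  rw [hQs] at hQ1
  have h4 : (#A : ℝ) * #B
      ≤ 12 * L ^ j * ∑ x ∈ A, ∑ y ∈ B, (f x y - 5 / 4) * w t y * f x y' := by
    have h5 := mul_le_mul_of_nonneg_right hQ1 (mul_pos hA0 hB0).le
    rw [mul_assoc, div_mul_cancel₀ _ (mul_pos hA0 hB0).ne'] at h5
    linarith
  refine h4.trans ?_
  have : 12 * L ^ j * (L * L ^ j * ∑ x ∈ U, ∑ y ∈ W, (f x y - 5 / 4))
      = 12 * L ^ (2 * j + 1) * ∑ x ∈ U, ∑ y ∈ W, (f x y - 5 / 4) := by ring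
  rw [← this]
  gcongr

/-- If a centred self-correlation has a large `p`-th moment, then `f` has density at least `5 / 4` on
a rectangle that is not too small. -/
theorem exists_rectangle_of_moment {A : Finset X} (hA : A.Nonempty) {B : Finset Y}
    (hB : B.Nonempty) {f : X → Y → ℝ} {L : ℝ} (hL : 1 ≤ L)
    (hf0 : ∀ x ∈ A, ∀ y ∈ B, 0 ≤ f x y) (hfL : ∀ x ∈ A, ∀ y ∈ B, f x y ≤ L)
    (hf : ∀ y ∈ B, 𝔼 x ∈ A, f x y = 1) {p : ℕ} (hp : 1 ≤ p) {γ : ℝ}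
    (hγ : 2 * p ≤ 2 ^ p * γ)
    (h : γ ≤ 𝔼 y ∈ B, 𝔼 y' ∈ B,
        corr A (fun x y => f x y - 1) (fun x y => f x y - 1) y y' ^ p) :
    ∃ U ⊆ A, ∃ W ⊆ B,
      (#A : ℝ) * #B ≤ 12 * L ^ (4 * p) * ∑ x ∈ U, ∑ y ∈ W, (f x y - 5 / 4) := by
  have hp0 : (0 : ℝ) < p := by exact_mod_cast hp
  have hγ0 : 0 < γ := by
    by_contra! hneg
    have := mul_nonpos_of_nonneg_of_nonpos (by positivity : (0 : ℝ) ≤ 2 ^ p) hneg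
    linarith
  have hN : (2 : ℝ) ^ p ≤ 𝔼 y ∈ B, 𝔼 y' ∈ B, corr A f f y y' ^ (2 * p) := by
    refine le_trans ?_ (choose_mul_le_expect_corr_pow hA hf (by omega : p ≤ 2 * p))
    have hc : (4 : ℝ) ^ p ≤ 2 * p * (2 * p).choose p := by
      exact_mod_cast Nat.four_pow_le_two_mul_self_mul_centralBinom p hp
    have h4 : (4 : ℝ) ^ p = 2 ^ p * 2 ^ p := by rw [← mul_pow]; norm_num
    have h5 : (2 : ℝ) ^ p ≤ (2 * p).choose p * γ := by
      have h6 : 2 * p * (2 : ℝ) ^ p ≤ 2 * p * ((2 * p).choose p * γ) := by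
        calc 2 * p * (2 : ℝ) ^ p ≤ 2 ^ p * γ * 2 ^ p := by gcongr
          _ = 4 ^ p * γ := by rw [h4]; ring
          _ ≤ 2 * p * (2 * p).choose p * γ := by gcongr
          _ = _ := by ring
      exact le_of_mul_le_mul_left h6 (by positivity)
    exact h5.trans (mul_le_mul_of_nonneg_left h (by positivity))
  obtain ⟨j, hj, hr⟩ := exists_ratio_ge
    (N := fun j => 𝔼 y ∈ B, 𝔼 y' ∈ B, corr A f f y y' ^ j) (by simp [expect_const hB]) hp hN
  obtain ⟨U, hU, W, hW, h1⟩ := exists_rectangle_of_ratio hA hB (by linarith) hf0 hfL hf hr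
  refine ⟨U, hU, W, hW, h1.trans ?_⟩
  have hs : 0 ≤ ∑ x ∈ U, ∑ y ∈ W, (f x y - 5 / 4) := by
    by_contra! hneg
    have h2 : (0 : ℝ) ≤ #A * #B := by positivity
    have h3 := mul_neg_of_pos_of_neg (by positivity : (0 : ℝ) < 12 * L ^ (2 * j + 1)) hneg
    linarith
  gcongr
  omega

/-- If `f` and `g` have constant column averages `1` and `𝔼 h * (f ∘ g)` is much smaller than
expected, then `f` or `g` has density at least `5 / 4` on a rectangle that is not too small. -/
theorem exists_rectangle_of_few_triangles {A : Finset X} (hA : A.Nonempty) {B : Finset Y}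
    (hB : B.Nonempty) {C : Finset Z} (hC : C.Nonempty) {f : X → Y → ℝ} {g : X → Z → ℝ}
    {h : Y → Z → ℝ} {L : ℝ} (hL : 1 ≤ L)
    (hf0 : ∀ x ∈ A, ∀ y ∈ B, 0 ≤ f x y) (hfL : ∀ x ∈ A, ∀ y ∈ B, f x y ≤ L)
    (hf : ∀ y ∈ B, 𝔼 x ∈ A, f x y = 1)
    (hg0 : ∀ x ∈ A, ∀ z ∈ C, 0 ≤ g x z) (hgL : ∀ x ∈ A, ∀ z ∈ C, g x z ≤ L)
    (hg : ∀ z ∈ C, 𝔼 x ∈ A, g x z = 1)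
    (hh0 : ∀ y ∈ B, ∀ z ∈ C, 0 ≤ h y z) (hh2 : ∀ y ∈ B, ∀ z ∈ C, h y z ≤ 2)
    {p : ℕ} (hp : 1 ≤ p) (hpe : Even p)
    (hγ : 8 * p ≤ 2 ^ p * 𝔼 y ∈ B, 𝔼 z ∈ C, h y z)
    (hfew : 2 * p * 𝔼 y ∈ B, 𝔼 z ∈ C, h y z * corr A f g y z ≤ 𝔼 y ∈ B, 𝔼 z ∈ C, h y z) :
    (∃ U ⊆ A, ∃ W ⊆ B,
      (#A : ℝ) * #B ≤ 12 * L ^ (4 * p) * ∑ x ∈ U, ∑ y ∈ W, (f x y - 5 / 4)) ∨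
    ∃ U ⊆ A, ∃ W ⊆ C,
      (#A : ℝ) * #C ≤ 12 * L ^ (4 * p) * ∑ x ∈ U, ∑ z ∈ W, (g x z - 5 / 4) := by
  set η := 𝔼 y ∈ B, 𝔼 z ∈ C, h y z with hη
  set T := corr A (fun x y => f x y - 1) (fun x z => g x z - 1) with hT
  have hTfg : ∀ y ∈ B, ∀ z ∈ C, corr A f g y z = 1 + T y z := fun y hy z hz =>
    corr_eq_one_add hA (hf y hy) (hg z hz)
  have hp1 : (1 : ℝ) ≤ p := by exact_mod_cast hp
  -- Bernoulli: `T ^ p` lies above its tangent at `T = -1`.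
  have hbern : ∀ y ∈ B, ∀ z ∈ C, 1 - p * corr A f g y z ≤ T y z ^ p := by
    intro y hy z hz
    rw [hTfg y hy z hz]
    by_cases h1 : T y z ≤ 1
    · have := one_add_mul_le_pow (a := -T y z - 1) (by linarith) p
      rw [show 1 + (-T y z - 1) = -T y z by ring, hpe.neg_pow] at this
      linarith
    · have : 0 ≤ T y z ^ p := hpe.pow_nonneg _
      nlinarith
  have hmom : η / 4 ≤ 𝔼 y ∈ B, 𝔼 z ∈ C, T y z ^ p := by
    have h1 : η - p * 𝔼 y ∈ B, 𝔼 z ∈ C, h y z * corr A f g y z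
        ≤ 2 * 𝔼 y ∈ B, 𝔼 z ∈ C, T y z ^ p := by
      rw [hη]
      simp_rw [mul_expect, ← expect_sub_distrib]
      refine expect_le_expect fun y hy => expect_le_expect fun z hz => ?_
      have h2 := mul_le_mul_of_nonneg_left (hbern y hy z hz) (hh0 y hy z hz)
      have h3 := mul_le_mul_of_nonneg_right (hh2 y hy z hz) (hpe.pow_nonneg (T y z))
      linarith
    linarith
  have hη0 : 0 < η := by
    by_contra! hneg
    have := mul_nonpos_of_nonneg_of_nonpos (by positivity : (0 : ℝ) ≤ 2 ^ p) hneg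
    linarith
  have hcs := expect_corr_pow_sq_le A B C (fun x y => f x y - 1) (fun x z => g x z - 1) p
  rw [← hT] at hcs
  have hγ' : 2 * p ≤ 2 ^ p * (η / 4) := by linarith
  by_cases hcase : η / 4 ≤ 𝔼 y ∈ B, 𝔼 y' ∈ B,
      corr A (fun x y => f x y - 1) (fun x y => f x y - 1) y y' ^ p
  · exact Or.inl (exists_rectangle_of_moment hA hB hL hf0 hfL hf hp hγ' hcase)
  · refine Or.inr (exists_rectangle_of_moment hA hC hL hg0 hgL hg hp hγ' ?_)
    by_contra! hcon
    have hF := expect_corr_self_pow_nonneg A B (fun x y => f x y - 1) p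
    have h1 := mul_lt_mul'' (not_le.1 hcase) hcon hF
      (expect_corr_self_pow_nonneg A C (fun x z => g x z - 1) p)
    have h2 : (η / 4) * (η / 4) ≤ (𝔼 y ∈ B, 𝔼 z ∈ C, T y z ^ p) ^ 2 := by
      rw [← sq]
      exact pow_le_pow_left₀ (by positivity) hmom 2
    linarith

end Sifting

/-! ### The randomized protocol -/

section Randomized

/-- With two hash functions `h₁, h₂ : G → Bool`, Alice announces the hashes of her value `α a`, then
Bob and Charlie each announce whether the hashes of their own values agree with hers. -/
def hashProtocol {A B C G : Type*} (h₁ h₂ : G → Bool) (α : A → G) (β : B → G) (γ : C → G) :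
    Protocol A B C :=
  let check (b₁ b₂ : Bool) : Protocol A B C :=
    .bob (fun b => (h₁ (β b) == b₁) && (h₂ (β b) == b₂)) (.output false)
      (.charlie (fun c => (h₁ (γ c) == b₁) && (h₂ (γ c) == b₂)) (.output false) (.output true))
  .alice (fun a => h₁ (α a))
    (.alice (fun a => h₂ (α a)) (check false false) (check false true))
    (.alice (fun a => h₂ (α a)) (check true false) (check true true))

theorem cost_hashProtocol {A B C G : Type*} (h₁ h₂ : G → Bool) (α : A → G) (β : B → G)
    (γ : C → G) : (hashProtocol h₁ h₂ α β γ).cost = 4 := by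
  simp [hashProtocol, Protocol.cost]

theorem run_hashProtocol {A B C G : Type*} (h₁ h₂ : G → Bool) (α : A → G) (β : B → G)
    (γ : C → G) (a : A) (b : B) (c : C) :
    (hashProtocol h₁ h₂ α β γ).run a b c = true ↔
      (h₁ (β b) = h₁ (α a) ∧ h₂ (β b) = h₂ (α a)) ∧
        h₁ (γ c) = h₁ (α a) ∧ h₂ (γ c) = h₂ (α a) := by
  cases e₁ : h₁ (α a) <;> cases e₂ : h₂ (α a) <;>
    simp [hashProtocol, Protocol.run, e₁, e₂]

/-- Two independent random bits per hash value collide with probability at most `1 / 4`. -/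
theorem four_mul_card_collisions_le {ι : Type*} [Fintype ι] [DecidableEq ι] {i i' j j' : ι}
    (hi : i ≠ i') (hj : j ≠ j') (hij : i ≠ j) (hij' : i ≠ j') (hi'j : i' ≠ j) :
    4 * #{r : ι → Bool | r i = r i' ∧ r j = r j'} ≤ 2 ^ Fintype.card ι := by
  -- Changing the bits at `i` and `j` embeds four copies of the set into the cube.
  set E : Finset (ι → Bool) := {r | r i = r i' ∧ r j = r j'} with hE
  let flip : (ι → Bool) × Bool × Bool → ι → Bool := fun p =>
    Function.update (Function.update p.1 i (xor (p.1 i) p.2.1)) j (xor (p.1 j) p.2.2)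
  have hinj : Set.InjOn flip (E ×ˢ (univ : Finset (Bool × Bool)) : Finset _) := by
    rintro ⟨r, b, b'⟩ hr ⟨s, c, c'⟩ hs heq
    simp only [coe_product, Set.mem_prod, mem_coe, hE, mem_filter, mem_univ, true_and,
      and_true] at hr hs
    have hval : ∀ l, flip (r, b, b') l = flip (s, c, c') l := fun l => congrFun heq l
    have hother : ∀ l, l ≠ i → l ≠ j → r l = s l := fun l h1 h2 => by
      simpa [flip, h1, h2] using hval l
    have h1 := hother i' hi.symm hi'j
    have h2 := hother j' hij'.symm hj.symm
    have h3 : r i = s i := by rw [hr.1, hs.1, h1]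
    have h4 : r j = s j := by rw [hr.2, hs.2, h2]
    have h5 : b = c := by simpa [flip, hij, h3] using hval i
    have h6 : b' = c' := by simpa [flip, h4] using hval j
    have h7 : r = s := by
      ext l
      by_cases e1 : l = i
      · rw [e1, h3]
      · by_cases e2 : l = j
        · rw [e2, h4]
        · rw [hother l e1 e2]
    rw [h5, h6, h7]
  have h := card_le_card_of_injOn flip (fun _ _ => mem_univ _) hinj
  rw [card_product, card_univ, card_univ, Fintype.card_fun, Fintype.card_prod,
    Fintype.card_bool] at h
  linarith

theorem hasRandNOF_ipTriple (F : Type*) [Field F] [Fintype F] (k : ℕ) :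
    HasRandNOF (ipTriple F k) 4 := by
  classical
  let e : F × Bool ≃ Fin (Fintype.card (F × Bool)) := Fintype.equivFin _
  let P : (Fin (Fintype.card (F × Bool)) → Bool) →
      Protocol ((Fin k → F) × (Fin k → F)) ((Fin k → F) × (Fin k → F))
        ((Fin k → F) × (Fin k → F)) := fun r =>
    hashProtocol (fun u => r (e (u, false))) (fun u => r (e (u, true)))
      (fun p => p.1 ⬝ᵥ p.2) (fun p => p.1 ⬝ᵥ p.2) (fun p => p.1 ⬝ᵥ p.2)
  refine ⟨_, P, fun r => (cost_hashProtocol ..).le, fun x y z => ?_⟩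
  have hcoll : ∀ u v : F, u ≠ v →
      (∀ r, (P r).run (y, z) (x, z) (x, y) ≠ ipTriple F k x y z →
        r (e (u, false)) = r (e (v, false)) ∧ r (e (u, true)) = r (e (v, true))) →
      ((univ.filter fun r => (P r).run (y, z) (x, z) (x, y) ≠ ipTriple F k x y z).card : ℝ)
        / 2 ^ (Fintype.card (F × Bool)) ≤ 1 / 3 := by
    intro u v huv h
    have h1 := four_mul_card_collisions_le (i := e (u, false)) (i' := e (v, false))
      (j := e (u, true)) (j' := e (v, true)) (by simp [huv]) (by simp [huv]) (by simp) (by simp)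
      (by simp)
    rw [Fintype.card_fin] at h1
    have h2 := card_le_card (monotone_filter_right univ
      (p := fun r => (P r).run (y, z) (x, z) (x, y) ≠ ipTriple F k x y z)
      (q := fun r => r (e (u, false)) = r (e (v, false)) ∧ r (e (u, true)) = r (e (v, true)))
      (fun r _ hr => h r hr))
    have h3 : (4 : ℝ) * (univ.filter fun r =>
        (P r).run (y, z) (x, z) (x, y) ≠ ipTriple F k x y z).card
          ≤ 2 ^ (Fintype.card (F × Bool)) := by
      exact_mod_cast (Nat.mul_le_mul_left 4 h2).trans h1
    rw [div_le_iff₀ (by positivity)]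
    have : (0 : ℝ) < 2 ^ (Fintype.card (F × Bool)) := by positivity
    linarith
  have hrun : ∀ r, (P r).run (y, z) (x, z) (x, y) = true ↔
      (r (e (x ⬝ᵥ z, false)) = r (e (y ⬝ᵥ z, false)) ∧
        r (e (x ⬝ᵥ z, true)) = r (e (y ⬝ᵥ z, true))) ∧
      (r (e (x ⬝ᵥ y, false)) = r (e (y ⬝ᵥ z, false)) ∧
        r (e (x ⬝ᵥ y, true)) = r (e (y ⬝ᵥ z, true))) := fun r => run_hashProtocol ..
  by_cases hxz : x ⬝ᵥ z = y ⬝ᵥ z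
  · by_cases hxy : x ⬝ᵥ y = y ⬝ᵥ z
    · have hD : ipTriple F k x y z = true := by simp [ipTriple, hxz, hxy]
      rw [filter_eq_empty_iff.2]
      · simp
      · intro r _
        rw [not_not, hD, hrun, hxz, hxy]
        simp
    · have hD : ipTriple F k x y z = false := by simp [ipTriple, hxz, hxy]
      refine hcoll _ _ hxy fun r hr => ?_
      rw [hD, ne_eq, Bool.not_eq_false, hrun] at hr
      exact hr.2
  · have hD : ipTriple F k x y z = false := by simp [ipTriple, hxz]
    refine hcoll _ _ hxz fun r hr => ?_
    rw [hD, ne_eq, Bool.not_eq_false, hrun] at hr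
    exact hr.1

end Randomized

/-! ### Covers by cylinder intersections -/

section Covers

/-- The inputs accepted by a protocol are covered by at most `2 ^ P.cost` boxes, one for each accepting
leaf. -/
theorem Protocol.exists_leaf_cover {A B C : Type*} (P : Protocol A B C) :
    ∃ (ι : Type) (_ : Fintype ι) (a : ι → A → Prop) (b : ι → B → Prop) (c : ι → C → Prop),
      Fintype.card ι ≤ 2 ^ P.cost ∧
        ∀ u v w, P.run u v w = true ↔ ∃ i, a i u ∧ b i v ∧ c i w := by
  have two_pow : ∀ m n : ℕ, 2 ^ m + 2 ^ n ≤ 2 ^ (max m n + 1) := fun m n => by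
    have h1 : 2 ^ m ≤ 2 ^ max m n := Nat.pow_le_pow_right two_pos (le_max_left m n)
    have h2 : 2 ^ n ≤ 2 ^ max m n := Nat.pow_le_pow_right two_pos (le_max_right m n)
    rw [pow_succ]
    omega
  induction P with
  | output o =>
    refine ⟨Unit, inferInstance, fun _ _ => o = true, fun _ _ => True, fun _ _ => True, ?_, ?_⟩
    · simp [Protocol.cost]
    · simp [Protocol.run]
  | alice msg p₀ p₁ ih₀ ih₁ =>
    obtain ⟨ι₀, _, a₀, b₀, c₀, h₀, e₀⟩ := ih₀
    obtain ⟨ι₁, _, a₁, b₁, c₁, h₁, e₁⟩ := ih₁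
    refine ⟨ι₀ ⊕ ι₁, inferInstance,
      Sum.elim (fun i u => msg u = false ∧ a₀ i u) (fun i u => msg u = true ∧ a₁ i u),
      Sum.elim b₀ b₁, Sum.elim c₀ c₁, ?_, fun u v w => ?_⟩
    · rw [Fintype.card_sum]
      exact (add_le_add h₀ h₁).trans (two_pow _ _)
    · cases h : msg u <;> simp [Protocol.run, h, e₀, e₁]
  | bob msg p₀ p₁ ih₀ ih₁ =>
    obtain ⟨ι₀, _, a₀, b₀, c₀, h₀, e₀⟩ := ih₀
    obtain ⟨ι₁, _, a₁, b₁, c₁, h₁, e₁⟩ := ih₁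
    refine ⟨ι₀ ⊕ ι₁, inferInstance, Sum.elim a₀ a₁,
      Sum.elim (fun i u => msg u = false ∧ b₀ i u) (fun i u => msg u = true ∧ b₁ i u),
      Sum.elim c₀ c₁, ?_, fun u v w => ?_⟩
    · rw [Fintype.card_sum]
      exact (add_le_add h₀ h₁).trans (two_pow _ _)
    · cases h : msg v <;> simp [Protocol.run, h, e₀, e₁]
  | charlie msg p₀ p₁ ih₀ ih₁ =>
    obtain ⟨ι₀, _, a₀, b₀, c₀, h₀, e₀⟩ := ih₀
    obtain ⟨ι₁, _, a₁, b₁, c₁, h₁, e₁⟩ := ih₁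
    refine ⟨ι₀ ⊕ ι₁, inferInstance, Sum.elim a₀ a₁, Sum.elim b₀ b₁,
      Sum.elim (fun i u => msg u = false ∧ c₀ i u) (fun i u => msg u = true ∧ c₁ i u), ?_,
      fun u v w => ?_⟩
    · rw [Fintype.card_sum]
      exact (add_le_add h₀ h₁).trans (two_pow _ _)
    · cases h : msg w <;> simp [Protocol.run, h, e₀, e₁]

/-- A nondeterministic protocol of cost `n` covers `f ⁻¹ 1` by at most `2 ^ n` cylinder
intersections. -/
theorem HasNondetNOF.exists_cylinder_cover {X Y Z : Type*} {f : X → Y → Z → Bool} {n : ℕ}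
    (h : HasNondetNOF f n) :
    ∃ (ι : Type) (_ : Fintype ι) (a : ι → Y → Z → Prop) (b : ι → X → Z → Prop)
      (c : ι → X → Y → Prop), Fintype.card ι ≤ 2 ^ n ∧
        ∀ x y z, f x y z = true ↔ ∃ i, a i y z ∧ b i x z ∧ c i x y := by
  obtain ⟨m, P, hP, hf⟩ := h
  obtain ⟨ι, hι, a, b, c, hcard, hrun⟩ := P.exists_leaf_cover
  refine ⟨ι, hι, fun i y z => ∃ u, a i ((y, z), u), fun i x z => ∃ v, b i ((x, z), v),
    fun i x y => ∃ w, c i ((x, y), w), hcard.trans (Nat.pow_le_pow_right two_pos hP),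
    fun x y z => ?_⟩
  rw [hf]
  constructor
  · rintro ⟨u, v, w, h⟩
    obtain ⟨i, ha, hb, hc⟩ := (hrun _ _ _).1 h
    exact ⟨i, ⟨u, ha⟩, ⟨v, hb⟩, ⟨w, hc⟩⟩
  · rintro ⟨i, ⟨u, ha⟩, ⟨v, hb⟩, ⟨w, hc⟩⟩
    exact ⟨u, v, w, (hrun _ _ _).2 ⟨i, ha, hb, hc⟩⟩

/-- The protocol in which each player first applies a map to what that player sees. -/
def Protocol.comap {A B C A' B' C' : Type*} (α : A' → A) (β : B' → B) (γ : C' → C) :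
    Protocol A B C → Protocol A' B' C'
  | .output b => .output b
  | .alice msg p₀ p₁ => .alice (msg ∘ α) (p₀.comap α β γ) (p₁.comap α β γ)
  | .bob msg p₀ p₁ => .bob (msg ∘ β) (p₀.comap α β γ) (p₁.comap α β γ)
  | .charlie msg p₀ p₁ => .charlie (msg ∘ γ) (p₀.comap α β γ) (p₁.comap α β γ)

theorem Protocol.cost_comap {A B C A' B' C' : Type*} (α : A' → A) (β : B' → B) (γ : C' → C)
    (P : Protocol A B C) : (P.comap α β γ).cost = P.cost := by
  induction P <;> simp_all [Protocol.comap, Protocol.cost]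

theorem Protocol.run_comap {A B C A' B' C' : Type*} (α : A' → A) (β : B' → B) (γ : C' → C)
    (P : Protocol A B C) (a : A') (b : B') (c : C') :
    (P.comap α β γ).run a b c = P.run (α a) (β b) (γ c) := by
  induction P <;> simp_all [Protocol.comap, Protocol.run]

theorem HasDetNOF.hasNondetNOF {X Y Z : Type*} {f : X → Y → Z → Bool} {n : ℕ}
    (h : HasDetNOF f n) : HasNondetNOF f n := by
  obtain ⟨P, hP, hf⟩ := h
  refine ⟨0, P.comap Prod.fst Prod.fst Prod.fst, by rwa [Protocol.cost_comap], fun x y z => ?_⟩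
  simp [Protocol.run_comap, hf]

/-- A protocol that sends no bits has a constant output, and `ipTriple` is not constant. -/
theorem HasNondetNOF.one_le_of_ipTriple {F : Type*} [Field F] {k n : ℕ} (hk : 0 < k)
    (h : HasNondetNOF (ipTriple F k) n) : 1 ≤ n := by
  by_contra! hn
  obtain ⟨m, P, hP, hf⟩ := h
  have h0 : P.cost = 0 := by omega
  obtain ⟨o, rfl⟩ : ∃ o, P = .output o := by
    cases P with
    | output o => exact ⟨o, rfl⟩
    | alice => simp [Protocol.cost] at h0
    | bob => simp [Protocol.cost] at h0
    | charlie => simp [Protocol.cost] at h0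
  have h1 := (hf 0 0 0).1 (by simp [ipTriple])
  obtain ⟨u, v, w, ho⟩ := h1
  have h2 := (hf (Pi.single ⟨0, hk⟩ 1) (Pi.single ⟨0, hk⟩ 1) 0).2
    ⟨u, v, w, by simpa [Protocol.run] using ho⟩
  simp [ipTriple] at h2

end Covers

/-! ### Density increments on cubes -/

section Cubes

variable {V : Type*}

/-- The density of `s` on the cube `A × B × C`. -/
noncomputable def cubeDensity (s : V → V → V → ℝ) (A B C : Finset V) : ℝ :=
  𝔼 x ∈ A, 𝔼 y ∈ B, 𝔼 z ∈ C, s x y z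

/-- The volume of the cube `A × B × C`. -/
def cubeVolume (A B C : Finset V) : ℝ := (#A : ℝ) * #B * #C

theorem cubeDensity_nonneg {s : V → V → V → ℝ} (hs : ∀ x y z, 0 ≤ s x y z) (A B C : Finset V) :
    0 ≤ cubeDensity s A B C :=
  expect_nonneg fun _ _ => expect_nonneg fun _ _ => expect_nonneg fun _ _ => hs _ _ _

theorem cubeDensity_swap_right (s : V → V → V → ℝ) (A B C : Finset V) :
    cubeDensity (fun x z y => s x y z) A C B = cubeDensity s A B C :=
  expect_congr rfl fun _ _ => expect_comm _ _ _

theorem cubeDensity_rotate (s : V → V → V → ℝ) (A B C : Finset V) :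
    cubeDensity (fun y z x => s x y z) B C A = cubeDensity s A B C := by
  unfold cubeDensity
  rw [expect_congr rfl fun _ _ => expect_comm _ _ _, expect_comm]

theorem cubeVolume_swap_right (A B C : Finset V) : cubeVolume A C B = cubeVolume A B C := by
  unfold cubeVolume; ring

theorem cubeVolume_rotate (A B C : Finset V) : cubeVolume B C A = cubeVolume A B C := by
  unfold cubeVolume; ring

theorem cubeVolume_nonneg (A B C : Finset V) : 0 ≤ cubeVolume A B C := by
  unfold cubeVolume; positivity

/-- `A × B × C` maximizes `density ^ (R + 1) * volume` among all cubes of volume at least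
`|V| ^ 3 / q`. -/
structure IsMaximalCube [Fintype V] (q : ℝ) (R : ℕ) (s : V → V → V → ℝ) (A B C : Finset V) :
    Prop where
  large : (Fintype.card V : ℝ) ^ 3 ≤ q * cubeVolume A B C
  maximal : ∀ A' B' C' : Finset V, (Fintype.card V : ℝ) ^ 3 ≤ q * cubeVolume A' B' C' →
    cubeDensity s A' B' C' ^ (R + 1) * cubeVolume A' B' C'
      ≤ cubeDensity s A B C ^ (R + 1) * cubeVolume A B C

theorem exists_isMaximalCube [Fintype V] {q : ℝ} (hq : 1 ≤ q) (R : ℕ) (s : V → V → V → ℝ) :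
    ∃ A B C, IsMaximalCube q R s A B C := by
  classical
  set T : Finset (Finset V × Finset V × Finset V) :=
    {c | (Fintype.card V : ℝ) ^ 3 ≤ q * cubeVolume c.1 c.2.1 c.2.2} with hT
  have hne : T.Nonempty := by
    refine ⟨(univ, univ, univ), ?_⟩
    rw [hT, mem_filter]
    refine ⟨mem_univ _, ?_⟩
    simp only [cubeVolume, card_univ]
    have : (0 : ℝ) ≤ (Fintype.card V : ℝ) ^ 3 := by positivity
    nlinarith
  obtain ⟨⟨A, B, C⟩, hc, hmax⟩ := T.exists_max_image
    (fun c => cubeDensity s c.1 c.2.1 c.2.2 ^ (R + 1) * cubeVolume c.1 c.2.1 c.2.2) hne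
  exact ⟨A, B, C, (mem_filter.1 hc).2, fun A' B' C' h =>
    hmax (A', B', C') (mem_filter.2 ⟨mem_univ _, h⟩)⟩

theorem IsMaximalCube.swap_right [Fintype V] {q : ℝ} {R : ℕ} {s : V → V → V → ℝ}
    {A B C : Finset V} (h : IsMaximalCube q R s A B C) :
    IsMaximalCube q R (fun x z y => s x y z) A C B where
  large := by rw [cubeVolume_swap_right]; exact h.large
  maximal A' B' C' h' := by
    rw [cubeVolume_swap_right] at h'
    rw [cubeDensity_swap_right s A' C' B', cubeDensity_swap_right s A B C, cubeVolume_swap_right A' C' B',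
      cubeVolume_swap_right A B C]
    exact h.maximal A' C' B' h'

/-- A maximal cube of positive density has no subcube of comparable volume on which the density is
larger by a factor `9 / 8`. -/
theorem IsMaximalCube.not_increment [Fintype V] {q : ℝ} {ℓ : ℕ} {s : V → V → V → ℝ}
    {A B C : Finset V} (h : IsMaximalCube q (10 * ℓ) s A B C) (hpos : 0 < cubeDensity s A B C)
    {A' B' C' : Finset V} (hv0 : 0 < cubeVolume A B C)
    (hV : (Fintype.card V : ℝ) ^ 3 * 2 ^ ℓ ≤ q * cubeVolume A B C) (hq : 0 ≤ q)
    (hv : cubeVolume A B C ≤ 2 ^ ℓ * cubeVolume A' B' C') :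
    cubeDensity s A' B' C' < 9 / 8 * cubeDensity s A B C := by
  by_contra! hcon
  have hv' : 0 < cubeVolume A' B' C' :=
    pos_of_mul_pos_right (lt_of_lt_of_le hv0 hv) (by positivity)
  have h1 := h.maximal A' B' C' (by
    have h2 : q * cubeVolume A B C ≤ q * (2 ^ ℓ * cubeVolume A' B' C') := by gcongr
    have h3 : (Fintype.card V : ℝ) ^ 3 * 2 ^ ℓ ≤ q * cubeVolume A' B' C' * 2 ^ ℓ := by linarith
    exact le_of_mul_le_mul_right h3 (by positivity))
  set D := cubeDensity s A B C ^ (10 * ℓ + 1) with hD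
  have hD0 : 0 < D := by positivity
  have h2 : (9 / 8 : ℝ) ^ (10 * ℓ + 1) * D ≤ cubeDensity s A' B' C' ^ (10 * ℓ + 1) := by
    rw [hD, ← mul_pow]
    exact pow_le_pow_left₀ (by positivity) hcon _
  have h3 : (9 / 8 : ℝ) ^ (10 * ℓ + 1) * D * cubeVolume A' B' C'
      ≤ 2 ^ ℓ * D * cubeVolume A' B' C' := by
    calc _ ≤ cubeDensity s A' B' C' ^ (10 * ℓ + 1) * cubeVolume A' B' C' := by gcongr
      _ ≤ D * cubeVolume A B C := h1
      _ ≤ D * (2 ^ ℓ * cubeVolume A' B' C') := by gcongr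
      _ = _ := by ring
  have h4 := le_of_mul_le_mul_right (le_of_mul_le_mul_right h3 hv') hD0
  -- The exponent `10 * ℓ` is chosen because `2 ≤ (9 / 8) ^ 10`.
  have h5 : (2 : ℝ) ^ ℓ ≤ (9 / 8) ^ (10 * ℓ) := by
    rw [pow_mul]
    exact pow_le_pow_left₀ (by norm_num) (by norm_num) _
  have h6 : (0 : ℝ) < (9 / 8) ^ (10 * ℓ) := by positivity
  rw [pow_succ] at h4
  linarith

/-- If deleting `b` from `B` does not increase `(average) ^ (R + 1) * (size)`, then the value at `b`
is at least almost average. -/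
theorem le_of_erase_potential_le {ι : Type*} [DecidableEq ι] {B : Finset ι} {w : ι → ℝ}
    (hw : ∀ b ∈ B, 0 ≤ w b) {b : ι} (hb : b ∈ B) (hB : 2 ≤ #B) {R : ℕ} (hR : 19 ≤ R)
    (h : (𝔼 i ∈ B.erase b, w i) ^ (R + 1) * ((#B : ℝ) - 1) ≤ (𝔼 i ∈ B, w i) ^ (R + 1) * #B) :
    19 / 20 * 𝔼 i ∈ B, w i ≤ w b := by
  set n : ℝ := ((#B : ℕ) : ℝ) with hn
  have hn2 : 2 ≤ n := by rw [hn]; exact_mod_cast hB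
  set S := ∑ i ∈ B, w i with hS
  have hS0 : 0 ≤ S := sum_nonneg hw
  have hsum : ∑ i ∈ B.erase b, w i = S - w b := by rw [hS, ← add_sum_erase B w hb]; ring
  have hcard : (#(B.erase b) : ℝ) = n - 1 := by
    rw [card_erase_of_mem hb, Nat.cast_sub (by omega), Nat.cast_one]
  rw [expect_eq_sum_div_card, expect_eq_sum_div_card, hsum, hcard, ← hS, ← hn] at h
  rw [expect_eq_sum_div_card, ← hS, ← hn]
  rcases hS0.eq_or_lt with h0 | hSpos
  · rw [← h0]
    simpa using hw b hb
  -- In terms of `β = 1 - w b / S` and `α = 1 - 1 / n` the hypothesis says `β ^ (R + 1) ≤ α ^ R`.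
  set β := (S - w b) / S with hβ
  set α := (n - 1) / n with hα
  have hα0 : 0 < α := div_pos (by linarith) (by linarith)
  have hn0 : n ≠ 0 := by linarith
  have hn1 : n - 1 ≠ 0 := by linarith
  have h1 : β ^ (R + 1) ≤ α ^ R := by
    have e1 : ((S - w b) / (n - 1)) ^ (R + 1) * (n - 1)
        = (β ^ (R + 1) / α ^ R) * (S ^ (R + 1) * (n / n ^ (R + 1))) := by
      rw [hβ, hα, div_pow, div_pow, div_pow, pow_succ n, pow_succ (n - 1)]
      field_simp
    have e2 : (S / n) ^ (R + 1) * n = S ^ (R + 1) * (n / n ^ (R + 1)) := by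
      rw [div_pow]; ring
    rw [e1, e2] at h
    have h2 : β ^ (R + 1) / α ^ R ≤ 1 := by
      by_contra! hcon
      have hpos : 0 < S ^ (R + 1) * (n / n ^ (R + 1)) := by positivity
      have := mul_lt_mul_of_pos_right hcon hpos
      linarith
    rwa [div_le_one (by positivity)] at h2
  have hα1 : α = 1 - 1 / n := by rw [hα]; field_simp
  have hR1 : (20 : ℝ) ≤ R + 1 := by
    have : (19 : ℝ) ≤ R := by exact_mod_cast hR
    linarith
  have hber : α ^ R ≤ (α + 1 / (n * (R + 1))) ^ (R + 1) := by
    have h2 := one_add_mul_le_pow (a := 1 / (n * (R + 1) * α))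
      (le_trans (by norm_num) (by positivity : (0 : ℝ) ≤ 1 / (n * (R + 1) * α))) (R + 1)
    have h3 : 1 + ((R + 1 : ℕ) : ℝ) * (1 / (n * (R + 1) * α)) = 1 / α := by
      push_cast
      have : 1 / α = (α + 1 / n) / α := by rw [hα1]; ring
      rw [this]
      field_simp
    rw [h3] at h2
    have h4 : α + 1 / (n * (R + 1)) = α * (1 + 1 / (n * (R + 1) * α)) := by
      field_simp
    rw [h4, mul_pow]
    calc α ^ R = α ^ (R + 1) * (1 / α) := by rw [pow_succ]; field_simp
      _ ≤ _ := by gcongr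
  have h2 : β ≤ α + 1 / (n * (R + 1)) :=
    le_of_pow_le_pow_left₀ (Nat.succ_ne_zero R) (by positivity) (h1.trans hber)
  have h3 : 1 / (n * (R + 1)) ≤ 1 / (20 * n) := by
    apply one_div_le_one_div_of_le (by positivity)
    nlinarith
  have h4 : 1 - w b / S ≤ 1 - 19 / 20 * (1 / n) := by
    have : β = 1 - w b / S := by rw [hβ]; field_simp
    rw [← this]
    have h5 : 1 / (20 * n) = 1 / 20 * (1 / n) := by field_simp
    linarith
  have h5 : 19 / 20 * (1 / n) * S ≤ w b / S * S := by
    apply mul_le_mul_of_nonneg_right _ hSpos.le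
    linarith
  rw [div_mul_cancel₀ _ hSpos.ne'] at h5
  calc 19 / 20 * (S / n) = 19 / 20 * (1 / n) * S := by ring
    _ ≤ w b := h5

/-- In a maximal cube every slice has almost at least the average density. -/
theorem IsMaximalCube.slice_ge [Fintype V] {q : ℝ} {R : ℕ} {s : V → V → V → ℝ}
    (hs : ∀ x y z, 0 ≤ s x y z) {A B C : Finset V} (h : IsMaximalCube q R s A B C)
    (hR : 19 ≤ R) (hq : 0 ≤ q) (hB : 2 ≤ #B) (hA : A.Nonempty) (hC : C.Nonempty)
    (hV : (Fintype.card V : ℝ) ^ 3 * 2 ≤ q * cubeVolume A B C) {y : V} (hy : y ∈ B) :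
    19 / 20 * cubeDensity s A B C ≤ 𝔼 x ∈ A, 𝔼 z ∈ C, s x y z := by
  classical
  have hd : ∀ B', cubeDensity s A B' C = 𝔼 y ∈ B', 𝔼 x ∈ A, 𝔼 z ∈ C, s x y z :=
    fun B' => expect_comm _ _ _
  have hA0 : (0 : ℝ) < #A := by exact_mod_cast hA.card_pos
  have hC0 : (0 : ℝ) < #C := by exact_mod_cast hC.card_pos
  have hB2 : (2 : ℝ) ≤ #B := by exact_mod_cast hB
  have hcard : (#(B.erase y) : ℝ) = #B - 1 := by
    rw [card_erase_of_mem hy, Nat.cast_sub (by omega), Nat.cast_one]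
  rw [hd]
  refine le_of_erase_potential_le (w := fun y => 𝔼 x ∈ A, 𝔼 z ∈ C, s x y z)
    (fun b _ => expect_nonneg fun _ _ => expect_nonneg fun _ _ => hs _ _ _) hy hB hR ?_
  have h1 := h.maximal A (B.erase y) C (by
    unfold cubeVolume at hV ⊢
    rw [hcard]
    have h2 : (#A : ℝ) * #B * #C ≤ 2 * (#A * (#B - 1) * #C) := by
      have : (#B : ℝ) ≤ 2 * (#B - 1) := by linarith
      calc (#A : ℝ) * #B * #C ≤ #A * (2 * (#B - 1)) * #C := by gcongr
        _ = _ := by ring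
    have := mul_le_mul_of_nonneg_left h2 hq
    linarith)
  rw [hd, hd, cubeVolume, cubeVolume, hcard] at h1
  have h2 : (0 : ℝ) < #A * #C := by positivity
  refine le_of_mul_le_mul_right ?_ h2
  calc _ = _ := by ring
    _ ≤ _ := h1
    _ = _ := by ring

end Cubes

/-! ### Truncated codegrees -/

section Truncation

variable {V : Type*} [Fintype V]

/-- Only a `q ^ (-20)` fraction of the pairs `(x, y)` have more than twice the expected density
`q ^ (-2)` of `z ∈ C` with `s x y z ≠ 0`, for every set `C` of density at least `1 / q`. -/
def FewHeavyPairs (q : ℝ) (s : V → V → V → ℝ) : Prop :=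
  ∀ C : Finset V, (Fintype.card V : ℝ) ≤ q * #C → ∃ H : Finset (V × V),
    #H * q ^ 20 ≤ (Fintype.card V : ℝ) ^ 2 ∧ ∀ x y, (x, y) ∉ H → q ^ 2 * 𝔼 z ∈ C, s x y z ≤ 2

/-- Discarding the heavy pairs gives a bounded function with almost the same averages as the
normalized codegree. -/
theorem FewHeavyPairs.exists_truncation {q : ℝ} (hq : 2 ≤ q) {s : V → V → V → ℝ}
    (hs0 : ∀ x y z, 0 ≤ s x y z) (hs1 : ∀ x y z, s x y z ≤ 1) (hH : FewHeavyPairs q s)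
    {A B C : Finset V} (hV : (Fintype.card V : ℝ) ^ 3 ≤ q * cubeVolume A B C)
    (hA : A.Nonempty) (hB : B.Nonempty) (hC : C.Nonempty) :
    ∃ f : V → V → ℝ, (∀ x y, 0 ≤ f x y) ∧ (∀ x y, f x y ≤ 2) ∧
      (∀ x y, f x y ≤ q ^ 2 * 𝔼 z ∈ C, s x y z) ∧ (∀ x y, f x y ≠ 0 → ∃ z, s x y z ≠ 0) ∧
      q ^ 2 * (𝔼 x ∈ A, 𝔼 y ∈ B, 𝔼 z ∈ C, s x y z) - 𝔼 x ∈ A, 𝔼 y ∈ B, f x y ≤ 1 / q ^ 17 := by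
  classical
  have hA0 : (0 : ℝ) < #A := by exact_mod_cast hA.card_pos
  have hB0 : (0 : ℝ) < #B := by exact_mod_cast hB.card_pos
  have hC0 : (0 : ℝ) < #C := by exact_mod_cast hC.card_pos
  set N : ℝ := ((Fintype.card V : ℕ) : ℝ) with hN
  have hle : ∀ S : Finset V, (#S : ℝ) ≤ N := fun S => by
    rw [hN]; exact_mod_cast card_le_univ S
  have hN0 : 0 < N := hA0.trans_le (hle A)
  have hq0 : 0 < q := by linarith
  unfold cubeVolume at hV
  have hCN : N ≤ q * #C := by
    have h1 : q * (#A * #B * #C) ≤ q * (N * N * #C) := by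
      gcongr
      · exact hle A
      · exact hle B
    have h2 : N * N ^ 2 ≤ q * #C * N ^ 2 := by
      calc N * N ^ 2 = N ^ 3 := by ring
        _ ≤ q * (N * N * #C) := hV.trans h1
        _ = _ := by ring
    exact le_of_mul_le_mul_right h2 (by positivity)
  have hABN : N ^ 2 ≤ q * (#A * #B) := by
    have h1 : q * (#A * #B * #C) ≤ q * (#A * #B * N) := by
      gcongr
      exact hle C
    have h2 : N ^ 2 * N ≤ q * (#A * #B) * N := by
      calc N ^ 2 * N = N ^ 3 := by ring
        _ ≤ q * (#A * #B * N) := hV.trans h1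
        _ = _ := by ring
    exact le_of_mul_le_mul_right h2 hN0
  obtain ⟨H, hHcard, hlight⟩ := hH C hCN
  have he0 : ∀ x y, 0 ≤ 𝔼 z ∈ C, s x y z := fun x y => expect_nonneg fun _ _ => hs0 _ _ _
  have he1 : ∀ x y, 𝔼 z ∈ C, s x y z ≤ 1 := fun x y => expect_le hC fun _ _ => hs1 _ _ _
  refine ⟨fun x y => if (x, y) ∈ H then 0 else q ^ 2 * 𝔼 z ∈ C, s x y z, fun x y => ?_,
    fun x y => ?_, fun x y => ?_, fun x y h => ?_, ?_⟩
  · dsimp only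
    split_ifs
    · exact le_rfl
    · exact mul_nonneg (by positivity) (he0 x y)
  · dsimp only
    split_ifs with h
    · norm_num
    · exact hlight x y h
  · dsimp only
    split_ifs
    · exact mul_nonneg (by positivity) (he0 x y)
    · exact le_rfl
  · dsimp only at h
    split_ifs at h with h'
    · exact absurd rfl h
    · obtain ⟨z, -, hz⟩ := exists_ne_zero_of_expect_ne_zero (right_ne_zero_of_mul h)
      exact ⟨z, hz⟩
  · rw [mul_expect, ← expect_sub_distrib]
    simp_rw [mul_expect B, ← expect_sub_distrib]
    rw [← expect_product' A B (fun x y => q ^ 2 * (𝔼 z ∈ C, s x y z)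
      - if (x, y) ∈ H then 0 else q ^ 2 * 𝔼 z ∈ C, s x y z), expect_eq_sum_div_card,
      card_product, Nat.cast_mul, div_le_iff₀ (by positivity)]
    calc ∑ p ∈ A ×ˢ B, (q ^ 2 * (𝔼 z ∈ C, s p.1 p.2 z)
          - if (p.1, p.2) ∈ H then 0 else q ^ 2 * 𝔼 z ∈ C, s p.1 p.2 z)
        ≤ ∑ p ∈ A ×ˢ B, if p ∈ H then q ^ 2 else 0 := by
          refine sum_le_sum fun p _ => ?_
          split_ifs
          · have := mul_le_mul_of_nonneg_left (he1 p.1 p.2) (by positivity : 0 ≤ q ^ 2)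
            linarith
          · rw [sub_self]
      _ ≤ ∑ p ∈ H, q ^ 2 := by
          rw [← sum_filter]
          refine sum_le_sum_of_subset_of_nonneg (fun p hp => (mem_filter.1 hp).2)
            fun _ _ _ => by positivity
      _ = #H * q ^ 2 := by rw [sum_const, nsmul_eq_mul]
      _ ≤ 1 / q ^ 17 * (#A * #B) := by
          rw [one_div, inv_mul_eq_div, le_div_iff₀ (by positivity)]
          have h1 : (#H * q ^ 2 * q ^ 17) * q ≤ (#A * #B) * q := by
            calc (#H * q ^ 2 * q ^ 17) * q = #H * q ^ 20 := by ring
              _ ≤ N ^ 2 := hHcard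
              _ ≤ _ := hABN
              _ = _ := by ring
          exact le_of_mul_le_mul_right h1 hq0

theorem FewHeavyPairs.cubeDensity_le {q : ℝ} (hq : 2 ≤ q) {s : V → V → V → ℝ}
    (hs0 : ∀ x y z, 0 ≤ s x y z) (hs1 : ∀ x y z, s x y z ≤ 1) (hH : FewHeavyPairs q s)
    {A B C : Finset V} (hV : (Fintype.card V : ℝ) ^ 3 ≤ q * cubeVolume A B C)
    (hA : A.Nonempty) (hB : B.Nonempty) (hC : C.Nonempty) :
    q ^ 2 * cubeDensity s A B C ≤ 4 := by
  obtain ⟨f, -, hf2, -, -, hf⟩ := hH.exists_truncation hq hs0 hs1 hV hA hB hC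
  have h1 : 𝔼 x ∈ A, 𝔼 y ∈ B, f x y ≤ 2 := expect_le hA fun x _ => expect_le hB fun y _ => hf2 x y
  have h2 : 1 / q ^ 17 ≤ 1 := by
    rw [div_le_one (by positivity)]
    exact one_le_pow₀ (by linarith)
  unfold cubeDensity
  linarith

/-- If `F ≤ G` pointwise, `G` is at least `19 / 20 * δ` everywhere and `F`, `G` have almost the same
average, then `F` is rarely below `9 / 10 * δ`. -/
theorem card_filter_lt_le {ι : Type*} {B : Finset ι} (hB : B.Nonempty) {F G : ι → ℝ} {δ ε : ℝ}
    (hFG : ∀ b ∈ B, F b ≤ G b) (hG : ∀ b ∈ B, 19 / 20 * δ ≤ G b)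
    (hε : (𝔼 b ∈ B, G b) - 𝔼 b ∈ B, F b ≤ ε) :
    (#{b ∈ B | F b < 9 / 10 * δ} : ℝ) * δ ≤ 20 * ε * #B := by
  have hB0 : (0 : ℝ) < #B := by exact_mod_cast hB.card_pos
  rw [← expect_sub_distrib, expect_eq_sum_div_card, div_le_iff₀ hB0] at hε
  have h1 : (#{b ∈ B | F b < 9 / 10 * δ} : ℝ) * (δ / 20) ≤ ∑ b ∈ B, (G b - F b) := by
    rw [← nsmul_eq_mul]
    refine (card_nsmul_le_sum _ _ _ fun b hb => ?_).trans
      (sum_le_sum_of_subset_of_nonneg (filter_subset _ _) fun b hb _ => sub_nonneg.2 (hFG b hb))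
    have h2 := mem_filter.1 hb
    have := hG b h2.1
    linarith [h2.2]
  linarith

/-- A dense rectangle for the normalized function `f / (column averages)` yields a density increment
for any `G ≥ f`. -/
theorem increment_of_rectangle {X Y : Type*} {A U : Finset X} {B W : Finset Y} {f G : X → Y → ℝ}
    {F : Y → ℝ} {δ L M : ℝ} (hδ : 0 < δ) (hA : A.Nonempty) (hB : B.Nonempty)
    (hF : ∀ y ∈ W, 9 / 10 * δ ≤ F y) (hf0 : ∀ x y, 0 ≤ f x y) (hfG : ∀ x y, f x y ≤ G x y)
    (hfL : ∀ x ∈ U, ∀ y ∈ W, f x y / F y ≤ L) (hM : 0 < M)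
    (h : (#A : ℝ) * #B ≤ M * ∑ x ∈ U, ∑ y ∈ W, (f x y / F y - 5 / 4)) :
    (#A : ℝ) * #B ≤ M * L * (#U * #W) ∧ 9 / 8 * δ ≤ 𝔼 x ∈ U, 𝔼 y ∈ W, G x y := by
  have hAB : (0 : ℝ) < #A * #B := by
    have := hA.card_pos
    have := hB.card_pos
    positivity
  have hS : 0 < ∑ x ∈ U, ∑ y ∈ W, (f x y / F y - 5 / 4) :=
    pos_of_mul_pos_right (hAB.trans_le h) hM.le
  have hUW : (∑ x ∈ U, ∑ y ∈ W, (f x y / F y - 5 / 4))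
      = (∑ x ∈ U, ∑ y ∈ W, f x y / F y) - 5 / 4 * (#U * #W) := by
    simp_rw [sum_sub_distrib, sum_const, nsmul_eq_mul]
    ring
  have hL : ∑ x ∈ U, ∑ y ∈ W, f x y / F y ≤ L * (#U * #W) := by
    refine (sum_le_sum fun x hx => sum_le_sum fun y hy => hfL x hx y hy).trans (le_of_eq ?_)
    simp_rw [sum_const, nsmul_eq_mul]
    ring
  have hUW0 : (0 : ℝ) ≤ #U * #W := by positivity
  refine ⟨h.trans ?_, ?_⟩
  · rw [mul_assoc]
    gcongr
    rw [hUW]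
    linarith
  · have h1 : 5 / 4 * (#U * #W : ℝ) < ∑ x ∈ U, ∑ y ∈ W, f x y / F y := by linarith
    have hUW1 : (0 : ℝ) < #U * #W := by
      refine hUW0.lt_of_ne fun h0 => ?_
      rw [← h0] at h1 hL
      linarith
    have h2 : 9 / 10 * δ * ∑ x ∈ U, ∑ y ∈ W, f x y / F y ≤ ∑ x ∈ U, ∑ y ∈ W, G x y := by
      simp_rw [mul_sum]
      refine sum_le_sum fun x hx => sum_le_sum fun y hy => le_trans ?_ (hfG x y)
      have hFy : 0 < F y := lt_of_lt_of_le (by positivity) (hF y hy)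
      calc 9 / 10 * δ * (f x y / F y) ≤ F y * (f x y / F y) := by
            have := hF y hy
            have := div_nonneg (hf0 x y) hFy.le
            gcongr
        _ = f x y := mul_div_cancel₀ _ hFy.ne'
    have h3 : 𝔼 x ∈ U, 𝔼 y ∈ W, G x y = (∑ x ∈ U, ∑ y ∈ W, G x y) / (#U * #W) := by
      simp_rw [expect_eq_sum_div_card, ← sum_div]
      rw [div_div, mul_comm (#W : ℝ)]
    rw [h3, le_div_iff₀ hUW1]
    have h4 : 9 / 10 * δ * (5 / 4 * (#U * #W)) ≤ 9 / 10 * δ * ∑ x ∈ U, ∑ y ∈ W, f x y / F y := by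
      gcongr
    linarith

end Truncation

/-! ### Cylinder intersections with few degenerate triangles -/

section CylinderIntersections

/-- Restricting a function bounded by `2` from `B × C` to `B₁ × C₁`. -/
theorem sum_sum_le_filter_add {Y Z : Type*} (B : Finset Y) (C : Finset Z) {h : Y → Z → ℝ}
    (h2 : ∀ y z, h y z ≤ 2) (P : Y → Prop) (Q : Z → Prop) [DecidablePred P] [DecidablePred Q] :
    ∑ y ∈ B, ∑ z ∈ C, h y z ≤ (∑ y ∈ B with P y, ∑ z ∈ C with Q z, h y z)
      + 2 * #{y ∈ B | ¬ P y} * #C + 2 * #B * #{z ∈ C | ¬ Q z} := by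
  have hsum : ∀ (S : Finset Y) (T : Finset Z), ∑ y ∈ S, ∑ z ∈ T, h y z ≤ 2 * #S * #T := by
    intro S T
    refine (sum_le_sum fun y _ => sum_le_sum fun z _ => h2 y z).trans (le_of_eq ?_)
    simp_rw [sum_const, nsmul_eq_mul]
    ring
  rw [← sum_filter_add_sum_filter_not B P]
  have h3 : ∑ y ∈ B with P y, ∑ z ∈ C, h y z = (∑ y ∈ B with P y, ∑ z ∈ C with Q z, h y z)
      + ∑ y ∈ B with P y, ∑ z ∈ C with ¬ Q z, h y z := by
    rw [← sum_add_distrib]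
    exact sum_congr rfl fun y _ => (sum_filter_add_sum_filter_not C Q _).symm
  have h4 := hsum {y ∈ B | ¬ P y} C
  have h5 := hsum {y ∈ B | P y} {z ∈ C | ¬ Q z}
  have h6 : 2 * (#{y ∈ B | P y} : ℝ) * #{z ∈ C | ¬ Q z} ≤ 2 * #B * #{z ∈ C | ¬ Q z} := by
    gcongr
    exact filter_subset _ _
  linarith

/-- The numerical consequences of `q ≥ 2 ^ (20000 d ^ 3)` that are used below. -/
theorem large_field_bounds {d : ℕ} (hd : 1 ≤ d) {q : ℝ} (hq : 2 ^ (20000 * d ^ 3) ≤ q) :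
    2 ^ ((d + 2) * (10 * (200 * d ^ 2) + 1) + 200 * d ^ 2) ≤ q ∧ 1280 * d * 4 ^ d ≤ q := by
  have h2 : d ^ 2 ≤ d ^ 3 := Nat.pow_le_pow_right hd (by norm_num)
  have h1 : d ≤ d ^ 2 := by nlinarith
  have h0 : 1 ≤ d ^ 2 := Nat.one_le_pow _ _ hd
  constructor
  · refine le_trans (pow_le_pow_right₀ one_le_two ?_) hq
    have : (d + 2) * (10 * (200 * d ^ 2) + 1) + 200 * d ^ 2
        = 2000 * d ^ 3 + 4200 * d ^ 2 + d + 2 := by ring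
    omega
  · have hd2 : (d : ℝ) ≤ 2 ^ d := by exact_mod_cast Nat.lt_two_pow_self.le
    calc 1280 * d * (4 : ℝ) ^ d ≤ 2 ^ 11 * 2 ^ d * (2 ^ 2) ^ d := by
          gcongr <;> norm_num
      _ = 2 ^ (11 + d + 2 * d) := by rw [pow_add, pow_add, pow_mul]
      _ ≤ 2 ^ (20000 * d ^ 3) := pow_le_pow_right₀ one_le_two (by omega)
      _ ≤ q := hq

theorem rectangle_loss_le {d : ℕ} (hd : 1 ≤ d) :
    2 * (12 * ((2 : ℝ) ^ (d + 2)) ^ (4 * (16 * d)) * 2 ^ (d + 2)) ≤ 2 ^ (200 * d ^ 2) := by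
  calc 2 * (12 * ((2 : ℝ) ^ (d + 2)) ^ (4 * (16 * d)) * 2 ^ (d + 2))
      ≤ 2 ^ 5 * ((2 : ℝ) ^ (d + 2)) ^ (4 * (16 * d)) * 2 ^ (d + 2) := by
        have : (0 : ℝ) < ((2 : ℝ) ^ (d + 2)) ^ (4 * (16 * d)) * 2 ^ (d + 2) := by positivity
        linarith
    _ = 2 ^ (5 + (d + 2) * (4 * (16 * d)) + (d + 2)) := by
        rw [← pow_mul, ← pow_add, ← pow_add]
    _ ≤ _ := pow_le_pow_right₀ one_le_two (by nlinarith)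

theorem triangle_loss_le {d : ℕ} {q δ : ℝ} (hq1 : 1 ≤ q) (hδ0 : 0 < δ)
    (hδq : 1280 * d ≤ q * δ ^ 2) :
    2 * ((16 * d : ℕ) : ℝ) * (8 / (9 / 10 * δ) ^ 2 * (δ / q ^ 2)) ≤ δ / 2 := by
  have hq0 : 0 < q := by linarith
  have e : 2 * ((16 * d : ℕ) : ℝ) * (8 / (9 / 10 * δ) ^ 2 * (δ / q ^ 2))
      = (25600 / 81 * d) / (δ * q ^ 2) := by
    push_cast
    field_simp
    ring
  rw [e, div_le_iff₀ (by positivity)]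
  have h1 : q * δ ^ 2 ≤ q ^ 2 * δ ^ 2 :=
    mul_le_mul_of_nonneg_right (le_self_pow₀ hq1 (by norm_num)) (sq_nonneg _)
  have h2 : δ / 2 * (δ * q ^ 2) = (q ^ 2 * δ ^ 2) / 2 := by ring
  rw [h2]
  linarith

theorem moment_gain_le {d : ℕ} (hd : 1 ≤ d) {δ : ℝ} (hδ1 : 1 ≤ 2 ^ d * δ) :
    8 * ((16 * d : ℕ) : ℝ) ≤ 2 ^ (16 * d) * (δ / 2) := by
  have hδ0 : 0 ≤ δ := (pos_of_mul_pos_right (zero_lt_one.trans_le hδ1) (by positivity)).le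
  have hd2 : (d : ℝ) ≤ 2 ^ d := by exact_mod_cast Nat.lt_two_pow_self.le
  have h1 : 256 * (d : ℝ) * 2 ^ d ≤ 2 ^ (16 * d) := by
    calc 256 * (d : ℝ) * 2 ^ d ≤ 2 ^ 8 * 2 ^ d * 2 ^ d := by
          gcongr
          norm_num
      _ = 2 ^ (8 + d + d) := by rw [pow_add, pow_add]
      _ ≤ _ := pow_le_pow_right₀ one_le_two (by omega)
  calc 8 * ((16 * d : ℕ) : ℝ) ≤ 8 * ((16 * d : ℕ) : ℝ) * (2 ^ d * δ) :=
        le_mul_of_one_le_right (by positivity) hδ1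
    _ = 256 * (d : ℝ) * 2 ^ d * (δ / 2) := by push_cast; ring
    _ ≤ _ := by gcongr

/-- The size and density of a maximal cube, given the density `2 ^ (-d) / q ^ 2` of the whole. -/
theorem IsMaximalCube.bounds {V : Type*} [Fintype V] {d R : ℕ} {q : ℝ} (hq : 0 < q)
    {s : V → V → V → ℝ} {A B C : Finset V} (h : IsMaximalCube q R s A B C)
    (hN : 0 < Fintype.card V)
    (hdens : 1 / 2 ^ d ≤ q ^ 2 * cubeDensity s univ univ univ)
    (hq1 : 1 ≤ q) (h0 : 0 ≤ cubeDensity s A B C) (h4 : q ^ 2 * cubeDensity s A B C ≤ 4) :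
    1 / 2 ^ d ≤ q ^ 2 * cubeDensity s A B C ∧
      (Fintype.card V : ℝ) ^ 3 ≤ 2 ^ ((d + 2) * (R + 1)) * cubeVolume A B C := by
  set N : ℝ := ((Fintype.card V : ℕ) : ℝ) with hNdef
  have hN0 : 0 < N := by rw [hNdef]; exact_mod_cast hN
  have hle : ∀ S : Finset V, (#S : ℝ) ≤ N := fun S => by
    rw [hNdef]; exact_mod_cast card_le_univ S
  have huniv : cubeVolume (univ : Finset V) univ univ = N ^ 3 := by
    simp only [cubeVolume, card_univ]; ring
  have hvN : cubeVolume A B C ≤ N ^ 3 := by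
    unfold cubeVolume
    calc (#A : ℝ) * #B * #C ≤ N * N * N := by
          gcongr
          · exact hle A
          · exact hle B
          · exact hle C
      _ = N ^ 3 := by ring
  have hv0 := cubeVolume_nonneg A B C
  set δ := q ^ 2 * cubeDensity s A B C with hδ
  have hδ0 : 0 ≤ δ := by positivity
  have key : (1 / 2 ^ d) ^ (R + 1) * N ^ 3 ≤ δ ^ (R + 1) * cubeVolume A B C := by
    have h1 := h.maximal univ univ univ (by
      rw [huniv]
      have : 0 < N ^ 3 := by positivity
      nlinarith)
    rw [huniv] at h1
    calc (1 / 2 ^ d) ^ (R + 1) * N ^ 3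
        ≤ (q ^ 2 * cubeDensity s univ univ univ) ^ (R + 1) * N ^ 3 := by gcongr
      _ = (q ^ 2) ^ (R + 1) * (cubeDensity s univ univ univ ^ (R + 1) * N ^ 3) := by
          rw [mul_pow]; ring
      _ ≤ (q ^ 2) ^ (R + 1) * (cubeDensity s A B C ^ (R + 1) * cubeVolume A B C) := by gcongr
      _ = _ := by rw [hδ, mul_pow]; ring
  constructor
  · have h1 : (1 / 2 ^ d) ^ (R + 1) * N ^ 3 ≤ δ ^ (R + 1) * N ^ 3 :=
      key.trans (by gcongr)
    exact le_of_pow_le_pow_left₀ (Nat.succ_ne_zero R) hδ0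
      (le_of_mul_le_mul_right h1 (by positivity))
  · have h1 : (1 / 2 ^ d) ^ (R + 1) * N ^ 3 ≤ 4 ^ (R + 1) * cubeVolume A B C :=
      key.trans (by gcongr)
    rw [one_div, inv_pow, inv_mul_le_iff₀ (by positivity)] at h1
    refine h1.trans (le_of_eq ?_)
    rw [pow_mul, pow_add (2 : ℝ) d 2, mul_pow]
    norm_num
    ring

/-- A triple of bounded functions supported on the three shadows of a cylinder intersection `s` has
small triangle density. -/
theorem expect_mul_corr_le {V : Type*} {s : V → V → V → ℝ} (hs : ∀ x y z, 0 ≤ s x y z)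
    (hcyl : ∀ x y z, (∃ z', s x y z' ≠ 0) → (∃ y', s x y' z ≠ 0) → (∃ x', s x' y z ≠ 0) →
      s x y z = 1)
    {A B C B₁ C₁ : Finset V} (hB₁ : B₁ ⊆ B) (hC₁ : C₁ ⊆ C) {f g h : V → V → ℝ} {F G : V → ℝ}
    {κ : ℝ} (hκ : 0 < κ)
    (hf0 : ∀ x y, 0 ≤ f x y) (hf2 : ∀ x y, f x y ≤ 2)
    (hfs : ∀ x y, f x y ≠ 0 → ∃ z, s x y z ≠ 0)
    (hg0 : ∀ x z, 0 ≤ g x z) (hg2 : ∀ x z, g x z ≤ 2)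
    (hgs : ∀ x z, g x z ≠ 0 → ∃ y, s x y z ≠ 0)
    (hh0 : ∀ y z, 0 ≤ h y z) (hh2 : ∀ y z, h y z ≤ 2)
    (hhs : ∀ y z, h y z ≠ 0 → ∃ x, s x y z ≠ 0)
    (hF : ∀ y ∈ B₁, κ ≤ F y) (hG : ∀ z ∈ C₁, κ ≤ G z) :
    ∑ y ∈ B₁, ∑ z ∈ C₁, h y z * corr A (fun x y => f x y / F y) (fun x z => g x z / G z) y z
      ≤ 8 / κ ^ 2 * (cubeDensity s A B C * (#B * #C)) := by
  have hpt : ∀ x, ∀ y ∈ B₁, ∀ z ∈ C₁,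
      h y z * (f x y / F y * (g x z / G z)) ≤ 8 / κ ^ 2 * s x y z := by
    intro x y hy z hz
    have hFy := hF y hy
    have hGz := hG z hz
    have hFy0 : 0 ≤ F y := hκ.le.trans hFy
    have e : h y z * (f x y / F y * (g x z / G z)) = h y z * f x y * g x z / (F y * G z) := by
      field_simp
    rw [e]
    by_cases h0 : h y z * f x y * g x z = 0
    · rw [h0, zero_div]
      exact mul_nonneg (by positivity) (hs x y z)
    · have h1 : s x y z = 1 := hcyl x y z (hfs x y fun e => h0 (by simp [e]))
        (hgs x z fun e => h0 (by simp [e])) (hhs y z fun e => h0 (by simp [e]))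
      rw [h1, mul_one]
      have h2 : h y z * f x y * g x z ≤ 2 * 2 * 2 := by
        have := hh0 y z; have := hf0 x y; have := hg0 x z
        gcongr
        · exact hh2 y z
        · exact hf2 x y
        · exact hg2 x z
      have h3 : κ ^ 2 ≤ F y * G z := by
        rw [sq]
        gcongr
      gcongr
      linarith
  have hsl : ∀ y z, 0 ≤ 𝔼 x ∈ A, s x y z := fun y z => expect_nonneg fun _ _ => hs _ _ _
  calc ∑ y ∈ B₁, ∑ z ∈ C₁,
        h y z * corr A (fun x y => f x y / F y) (fun x z => g x z / G z) y z
      ≤ ∑ y ∈ B₁, ∑ z ∈ C₁, 8 / κ ^ 2 * 𝔼 x ∈ A, s x y z := by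
        refine sum_le_sum fun y hy => sum_le_sum fun z hz => ?_
        rw [corr, mul_expect, mul_expect]
        exact expect_le_expect fun x _ => hpt x y hy z hz
    _ ≤ ∑ y ∈ B, ∑ z ∈ C, 8 / κ ^ 2 * 𝔼 x ∈ A, s x y z := by
        refine (sum_le_sum fun y _ => sum_le_sum_of_subset_of_nonneg hC₁ fun z _ _ =>
          mul_nonneg (by positivity) (hsl y z)).trans
          (sum_le_sum_of_subset_of_nonneg hB₁ fun y _ _ => sum_nonneg fun z _ =>
          mul_nonneg (by positivity) (hsl y z))
    _ = 8 / κ ^ 2 * (cubeDensity s A B C * (#B * #C)) := by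
        simp_rw [← mul_sum]
        rw [← cubeDensity_rotate, cubeDensity]
        simp_rw [← card_smul_expect, nsmul_eq_mul, ← mul_expect]
        ring

/-- Truncated shadows `f`, `g`, `h` of a cylinder intersection of relative density `δ ≥ 2 ^ (-d)` with
few sparse columns: `f` or `g` has density `9 / 8 * δ` on a large rectangle. -/
theorem exists_increment_of_shadows {V : Type*} {d : ℕ} (hd : 1 ≤ d) {q δ : ℝ}
    (hq1 : 1 ≤ q) (hδ0 : 0 < δ) (hδ4 : δ ≤ 4) (hδ1 : 1 ≤ 2 ^ d * δ) (hδq : 1280 * d ≤ q * δ ^ 2)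
    {s : V → V → V → ℝ} (hs0 : ∀ x y z, 0 ≤ s x y z)
    (hcyl : ∀ x y z, (∃ z', s x y z' ≠ 0) → (∃ y', s x y' z ≠ 0) → (∃ x', s x' y z ≠ 0) →
      s x y z = 1)
    {A B C : Finset V} (hA : A.Nonempty) (hB : B.Nonempty) (hC : C.Nonempty)
    (hDδ : cubeDensity s A B C = δ / q ^ 2) {f g h : V → V → ℝ}
    (hf0 : ∀ x y, 0 ≤ f x y) (hf2 : ∀ x y, f x y ≤ 2)
    (hfs : ∀ x y, f x y ≠ 0 → ∃ z, s x y z ≠ 0)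
    (hg0 : ∀ x z, 0 ≤ g x z) (hg2 : ∀ x z, g x z ≤ 2)
    (hgs : ∀ x z, g x z ≠ 0 → ∃ y, s x y z ≠ 0)
    (hh0 : ∀ y z, 0 ≤ h y z) (hh2 : ∀ y z, h y z ≤ 2)
    (hhs : ∀ y z, h y z ≠ 0 → ∃ x, s x y z ≠ 0)
    (hbadB : (#{y ∈ B | (𝔼 x ∈ A, f x y) < 9 / 10 * δ} : ℝ) ≤ δ / 16 * #B)
    (hbadC : (#{z ∈ C | (𝔼 x ∈ A, g x z) < 9 / 10 * δ} : ℝ) ≤ δ / 16 * #C)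
    (hhE : 3 / 4 * δ ≤ 𝔼 y ∈ B, 𝔼 z ∈ C, h y z) :
    (∃ U W : Finset V, (#A : ℝ) * #B ≤ 2 ^ (200 * d ^ 2) * (#U * #W) ∧
      9 / 8 * δ ≤ 𝔼 x ∈ U, 𝔼 y ∈ W, f x y) ∨
    ∃ U W : Finset V, (#A : ℝ) * #C ≤ 2 ^ (200 * d ^ 2) * (#U * #W) ∧
      9 / 8 * δ ≤ 𝔼 x ∈ U, 𝔼 z ∈ W, g x z := by
  classical
  have hA0 : (0 : ℝ) < #A := by exact_mod_cast hA.card_pos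
  have hB0 : (0 : ℝ) < #B := by exact_mod_cast hB.card_pos
  have hC0 : (0 : ℝ) < #C := by exact_mod_cast hC.card_pos
  have hq0 : 0 < q := by linarith
  obtain ⟨F, hF⟩ : ∃ F : V → ℝ, ∀ y, F y = 𝔼 x ∈ A, f x y := ⟨_, fun _ => rfl⟩
  obtain ⟨G, hG⟩ : ∃ G : V → ℝ, ∀ z, G z = 𝔼 x ∈ A, g x z := ⟨_, fun _ => rfl⟩
  simp only [← hF, ← hG, ← not_le] at hbadB hbadC
  obtain ⟨B₁, hB₁⟩ : ∃ B₁, B₁ = {y ∈ B | 9 / 10 * δ ≤ F y} := ⟨_, rfl⟩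
  obtain ⟨C₁, hC₁⟩ : ∃ C₁, C₁ = {z ∈ C | 9 / 10 * δ ≤ G z} := ⟨_, rfl⟩
  have hB₁B : B₁ ⊆ B := hB₁ ▸ filter_subset _ _
  have hC₁C : C₁ ⊆ C := hC₁ ▸ filter_subset _ _
  have hcardB : (#B : ℝ) / 2 ≤ #B₁ := by
    have h1 : (#B₁ : ℝ) + #{y ∈ B | ¬ 9 / 10 * δ ≤ F y} = #B := by
      rw [hB₁]
      exact_mod_cast card_filter_add_card_filter_not (s := B) (fun y => 9 / 10 * δ ≤ F y)
    have h2 : δ / 16 * #B ≤ 4 / 16 * #B := by gcongr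
    linarith
  have hcardC : (#C : ℝ) / 2 ≤ #C₁ := by
    have h1 : (#C₁ : ℝ) + #{z ∈ C | ¬ 9 / 10 * δ ≤ G z} = #C := by
      rw [hC₁]
      exact_mod_cast card_filter_add_card_filter_not (s := C) (fun z => 9 / 10 * δ ≤ G z)
    have h2 : δ / 16 * #C ≤ 4 / 16 * #C := by gcongr
    linarith
  have hB₁0 : (0 : ℝ) < #B₁ := by linarith
  have hC₁0 : (0 : ℝ) < #C₁ := by linarith
  have hB₁ne : B₁.Nonempty := card_pos.1 (by exact_mod_cast hB₁0)
  have hC₁ne : C₁.Nonempty := card_pos.1 (by exact_mod_cast hC₁0)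
  have hFδ : ∀ y ∈ B₁, 9 / 10 * δ ≤ F y := fun y hy => by
    rw [hB₁] at hy
    exact (mem_filter.1 hy).2
  have hGδ : ∀ z ∈ C₁, 9 / 10 * δ ≤ G z := fun z hz => by
    rw [hC₁] at hz
    exact (mem_filter.1 hz).2
  have hκ : 0 < 9 / 10 * δ := by positivity
  -- The third function keeps most of its mass on `B₁ × C₁`.
  have hmass : δ / 2 * (#B * #C) ≤ ∑ y ∈ B₁, ∑ z ∈ C₁, h y z := by
    have h1 := sum_sum_le_filter_add B C hh2 (fun y => 9 / 10 * δ ≤ F y)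
      (fun z => 9 / 10 * δ ≤ G z)
    have h2 : 𝔼 y ∈ B, 𝔼 z ∈ C, h y z = (∑ y ∈ B, ∑ z ∈ C, h y z) / (#B * #C) := by
      simp_rw [expect_eq_sum_div_card, ← sum_div]
      rw [div_div, mul_comm (#C : ℝ)]
    rw [h2] at hhE
    rw [le_div_iff₀ (by positivity)] at hhE
    have h4 : 2 * (#{y ∈ B | ¬ 9 / 10 * δ ≤ F y} : ℝ) * #C ≤ 2 * (δ / 16 * #B) * #C := by gcongr
    have h5 : 2 * (#B : ℝ) * #{z ∈ C | ¬ 9 / 10 * δ ≤ G z} ≤ 2 * #B * (δ / 16 * #C) := by gcongr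
    rw [← hB₁, ← hC₁] at h1
    linarith
  have hsumE : ∀ w : V → V → ℝ, 𝔼 y ∈ B₁, 𝔼 z ∈ C₁, w y z
      = (∑ y ∈ B₁, ∑ z ∈ C₁, w y z) / (#B₁ * #C₁) := fun w => by
    simp_rw [expect_eq_sum_div_card, ← sum_div]
    rw [div_div, mul_comm (#C₁ : ℝ)]
  have hEh : δ / 2 ≤ 𝔼 y ∈ B₁, 𝔼 z ∈ C₁, h y z := by
    rw [hsumE, le_div_iff₀ (by positivity)]
    refine le_trans ?_ hmass
    gcongr
  have hnorm : ∀ (u : V → V → ℝ) (U : V → ℝ) (S : Finset V), (∀ y, U y = 𝔼 x ∈ A, u x y) →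
      (∀ y ∈ S, 9 / 10 * δ ≤ U y) → ∀ y ∈ S, 𝔼 x ∈ A, u x y / U y = 1 := by
    intro u U S hU hS y hy
    rw [← expect_div, ← hU]
    exact div_self (lt_of_lt_of_le hκ (hS y hy)).ne'
  have hbound : ∀ (u : V → V → ℝ) (U : V → ℝ) (S : Finset V), (∀ x y, u x y ≤ 2) →
      (∀ y ∈ S, 9 / 10 * δ ≤ U y) → ∀ x, ∀ y ∈ S, u x y / U y ≤ 2 ^ (d + 2) := by
    intro u U S hu hS x y hy
    have hUy := hS y hy
    rw [div_le_iff₀ (lt_of_lt_of_le hκ hUy)]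
    calc u x y ≤ 2 := hu x y
      _ ≤ 4 * (9 / 10) * (2 ^ d * δ) := by linarith
      _ = 2 ^ (d + 2) * (9 / 10 * δ) := by rw [pow_add]; ring
      _ ≤ _ := by gcongr
  -- The product of the three functions is supported on `s`, whose density is only `δ / q ^ 2`.
  have hfew : 2 * ((16 * d : ℕ) : ℝ) * 𝔼 y ∈ B₁, 𝔼 z ∈ C₁,
      h y z * corr A (fun x y => f x y / F y) (fun x z => g x z / G z) y z
        ≤ 𝔼 y ∈ B₁, 𝔼 z ∈ C₁, h y z := by
    have h1 := expect_mul_corr_le (A := A) hs0 hcyl hB₁B hC₁C hκ hf0 hf2 hfs hg0 hg2 hgs hh0 hh2 hhs hFδ hGδ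
    rw [hsumE, hsumE, ← mul_div_assoc]
    refine div_le_div_of_nonneg_right ?_ (by positivity)
    refine le_trans (le_trans (mul_le_mul_of_nonneg_left h1 (by positivity)) ?_) hmass
    have h2 := triangle_loss_le hq1 hδ0 hδq
    calc _ = 2 * ((16 * d : ℕ) : ℝ) * (8 / (9 / 10 * δ) ^ 2 * (δ / q ^ 2)) * (#B * #C) := by
          rw [hDδ]; ring
      _ ≤ _ := by gcongr
  have hγ : 8 * ((16 * d : ℕ) : ℝ) ≤ 2 ^ (16 * d) * 𝔼 y ∈ B₁, 𝔼 z ∈ C₁, h y z :=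
    (moment_gain_le hd hδ1).trans (by gcongr)
  have hM : (0 : ℝ) < 12 * (2 ^ (d + 2)) ^ (4 * (16 * d)) := by positivity
  have hlarge : ∀ S S₁ U W : Finset V, (#S : ℝ) / 2 ≤ #S₁ →
      (#A : ℝ) * #S₁ ≤ 12 * (2 ^ (d + 2)) ^ (4 * (16 * d)) * 2 ^ (d + 2) * (#U * #W) →
      (#A : ℝ) * #S ≤ 2 ^ (200 * d ^ 2) * (#U * #W) := by
    intro S S₁ U W h1 h2
    have h3 : (#A : ℝ) * (#S / 2) ≤ #A * #S₁ := mul_le_mul_of_nonneg_left h1 hA0.le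
    have h4 := mul_le_mul_of_nonneg_right (rectangle_loss_le hd)
      (by positivity : (0 : ℝ) ≤ #U * #W)
    rw [mul_assoc 2] at h4
    linarith
  rcases exists_rectangle_of_few_triangles hA hB₁ne hC₁ne (one_le_pow₀ one_le_two)
    (fun x _ y hy => div_nonneg (hf0 x y) (hκ.le.trans (hFδ y hy)))
    (fun x _ y hy => hbound f F B₁ hf2 hFδ x y hy) (hnorm f F B₁ hF hFδ)
    (fun x _ z hz => div_nonneg (hg0 x z) (hκ.le.trans (hGδ z hz)))
    (fun x _ z hz => hbound g G C₁ hg2 hGδ x z hz) (hnorm g G C₁ hG hGδ)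
    (fun y _ z _ => hh0 y z) (fun y _ z _ => hh2 y z) (by omega : 1 ≤ 16 * d)
    ⟨8 * d, by ring⟩ hγ hfew with ⟨U, hU, W, hW, hUW⟩ | ⟨U, hU, W, hW, hUW⟩
  · obtain ⟨h1, h2⟩ := increment_of_rectangle hδ0 hA hB₁ne (fun y hy => hFδ y (hW hy)) hf0
      (fun _ _ => le_rfl) (fun x _ y hy => hbound f F B₁ hf2 hFδ x y (hW hy)) hM hUW
    exact Or.inl ⟨U, W, hlarge B B₁ U W hcardB h1, h2⟩
  · obtain ⟨h1, h2⟩ := increment_of_rectangle hδ0 hA hC₁ne (fun z hz => hGδ z (hW hz)) hg0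
      (fun _ _ => le_rfl) (fun x _ z hz => hbound g G C₁ hg2 hGδ x z (hW hz)) hM hUW
    exact Or.inr ⟨U, W, hlarge C C₁ U W hcardC h1, h2⟩

/-- A cylinder intersection with few heavy pairs in every direction has relative density less than
`2 ^ (-d)` as soon as `q ≥ 2 ^ (20000 d ^ 3)`. -/
theorem relative_density_lt {V : Type*} [Fintype V] {d : ℕ} (hd : 1 ≤ d) {q : ℝ}
    (hq : 2 ^ (20000 * d ^ 3) ≤ q) (hqV : q ^ 2 ≤ Fintype.card V) {s : V → V → V → ℝ}
    (hs : ∀ x y z, s x y z = 0 ∨ s x y z = 1)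
    (hcyl : ∀ x y z, (∃ z', s x y z' ≠ 0) → (∃ y', s x y' z ≠ 0) → (∃ x', s x' y z ≠ 0) →
      s x y z = 1)
    (hH₁ : FewHeavyPairs q s) (hH₂ : FewHeavyPairs q fun x z y => s x y z)
    (hH₃ : FewHeavyPairs q fun y z x => s x y z) :
    q ^ 2 * cubeDensity s univ univ univ < 1 / 2 ^ d := by
  classical
  by_contra! hdens
  have hs0 : ∀ x y z, 0 ≤ s x y z := fun x y z => by rcases hs x y z with h | h <;> simp [h]
  have hs1 : ∀ x y z, s x y z ≤ 1 := fun x y z => by rcases hs x y z with h | h <;> simp [h]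
  obtain ⟨hq_vol, hq_d⟩ := large_field_bounds hd hq
  have hd1 : (1 : ℝ) ≤ d := by exact_mod_cast hd
  have h4d : (1 : ℝ) ≤ 4 ^ d := one_le_pow₀ (by norm_num)
  have h2d : (1 : ℝ) ≤ 2 ^ d := one_le_pow₀ (by norm_num)
  have h24 : (4 : ℝ) ^ d = 2 ^ d * 2 ^ d := by rw [← mul_pow]; norm_num
  have hd4 : (4 : ℝ) ^ d ≤ d * 4 ^ d := le_mul_of_one_le_left (by positivity) hd1
  have hq1280 : 1280 * (4 : ℝ) ^ d ≤ q := by linarith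
  have hq2 : 2 ≤ q := by linarith
  have hq0 : 0 < q := by linarith
  obtain ⟨A, B, C, hmax⟩ := exists_isMaximalCube (by linarith : 1 ≤ q) (10 * (200 * d ^ 2)) s
  set N : ℝ := ((Fintype.card V : ℕ) : ℝ) with hN
  have hN0 : 0 < N := lt_of_lt_of_le (by positivity) hqV
  have hle : ∀ S : Finset V, (#S : ℝ) ≤ N := fun S => by
    rw [hN]; exact_mod_cast card_le_univ S
  have hside : ∀ S T U : Finset V, N ^ 3 ≤ q * cubeVolume S T U → 2 ≤ #T := by
    intro S T U h
    have h1 : q * cubeVolume S T U ≤ q * (N * #T * N) := by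
      unfold cubeVolume
      gcongr
      · exact hle S
      · exact hle U
    have h2 : N * N ^ 2 ≤ q * #T * N ^ 2 := by linarith
    have h3 := le_of_mul_le_mul_right h2 (by positivity)
    have h4 : q * q ≤ q * #T := by linarith
    have h5 := le_of_mul_le_mul_left h4 hq0
    exact_mod_cast hq2.trans h5
  have hB2 := hside A B C hmax.large
  have hC2 := hside A C B hmax.swap_right.large
  have hA2 := hside C A B (by rw [cubeVolume_rotate, cubeVolume_rotate]; exact hmax.large)
  have hA : A.Nonempty := card_pos.1 (by omega)
  have hB : B.Nonempty := card_pos.1 (by omega)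
  have hC : C.Nonempty := card_pos.1 (by omega)
  have hA0 : (0 : ℝ) < #A := by exact_mod_cast hA.card_pos
  have hB0 : (0 : ℝ) < #B := by exact_mod_cast hB.card_pos
  have hC0 : (0 : ℝ) < #C := by exact_mod_cast hC.card_pos
  have hv0 : 0 < cubeVolume A B C := by unfold cubeVolume; positivity
  have hD0 := cubeDensity_nonneg hs0 A B C
  have hδ4 := hH₁.cubeDensity_le hq2 hs0 hs1 hmax.large hA hB hC
  obtain ⟨hδd, hvol⟩ := hmax.bounds hq0 ((Nat.cast_pos (α := ℝ)).1 hN0) hdens (by linarith) hD0 hδ4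
  have hV : N ^ 3 * 2 ^ (200 * d ^ 2) ≤ q * cubeVolume A B C := by
    calc N ^ 3 * 2 ^ (200 * d ^ 2)
        ≤ 2 ^ ((d + 2) * (10 * (200 * d ^ 2) + 1)) * cubeVolume A B C * 2 ^ (200 * d ^ 2) := by
          gcongr
      _ = 2 ^ ((d + 2) * (10 * (200 * d ^ 2) + 1) + 200 * d ^ 2) * cubeVolume A B C := by
          rw [pow_add]; ring
      _ ≤ _ := by gcongr
  have hV2 : N ^ 3 * 2 ≤ q * cubeVolume A B C := by
    refine le_trans ?_ hV
    gcongr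
    exact le_self_pow₀ one_le_two (by positivity)
  set δ := q ^ 2 * cubeDensity s A B C with hδ
  have hδ0 : 0 < δ := lt_of_lt_of_le (by positivity) hδd
  have hDpos : 0 < cubeDensity s A B C := pos_of_mul_pos_right hδ0 (by positivity)
  -- `2 ^ (-d) ≤ δ` in the forms needed.
  have hδ1 : 1 ≤ 2 ^ d * δ := by
    rwa [div_le_iff₀' (by positivity)] at hδd
  have hδ2 : 1 ≤ 4 ^ d * δ ^ 2 := by
    calc (1 : ℝ) ≤ (2 ^ d * δ) ^ 2 := one_le_pow₀ hδ1
      _ = _ := by rw [h24]; ring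
  have hδq : 1280 * d ≤ q * δ ^ 2 := by
    calc 1280 * (d : ℝ) ≤ 1280 * d * (4 ^ d * δ ^ 2) := le_mul_of_one_le_right (by positivity) hδ2
      _ = 1280 * d * 4 ^ d * δ ^ 2 := by ring
      _ ≤ _ := by gcongr
  have hε : 20 * (1 / q ^ 17) ≤ δ ^ 2 / 16 := by
    have h1 : 1 / q ^ 17 ≤ 1 / q := by
      apply one_div_le_one_div_of_le hq0
      exact le_self_pow₀ (by linarith) (by norm_num)
    have h2 : 1 / q ≤ δ ^ 2 / 1280 := by
      rw [div_le_div_iff₀ hq0 (by norm_num)]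
      linarith
    have h3 : 0 ≤ δ ^ 2 := sq_nonneg _
    linarith
  obtain ⟨f, hf0, hf2, hfG, hfs, hfE⟩ := hH₁.exists_truncation hq2 hs0 hs1 hmax.large hA hB hC
  obtain ⟨g, hg0, hg2, hgG, hgs, hgE⟩ := hH₂.exists_truncation hq2 (fun _ _ _ => hs0 _ _ _)
    (fun _ _ _ => hs1 _ _ _) hmax.swap_right.large hA hC hB
  obtain ⟨h, hh0, hh2, hhG, hhs, hhE⟩ := hH₃.exists_truncation hq2 (fun _ _ _ => hs0 _ _ _)
    (fun _ _ _ => hs1 _ _ _) (by rw [cubeVolume_rotate]; exact hmax.large) hB hC hA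
  have hdens₂ : (𝔼 x ∈ A, 𝔼 z ∈ C, 𝔼 y ∈ B, s x y z) = cubeDensity s A B C :=
    cubeDensity_swap_right s A B C
  have hdens₃ : (𝔼 y ∈ B, 𝔼 z ∈ C, 𝔼 x ∈ A, s x y z) = cubeDensity s A B C :=
    cubeDensity_rotate s A B C
  have h19 : 19 ≤ 10 * (200 * d ^ 2) := by nlinarith
  -- The slices of a maximal cube are dense, so the truncated functions have few sparse columns.
  have hbadB : (#{y ∈ B | (𝔼 x ∈ A, f x y) < 9 / 10 * δ} : ℝ) ≤ δ / 16 * #B := by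
    have h1 := card_filter_lt_le hB (F := fun y => 𝔼 x ∈ A, f x y) (G := fun y => q ^ 2 * 𝔼 x ∈ A, 𝔼 z ∈ C, s x y z)
      (δ := δ) (ε := 1 / q ^ 17)
      (fun y _ => by
        rw [mul_expect]
        exact expect_le_expect fun x _ => hfG x y)
      (fun y hy => by
        have := hmax.slice_ge hs0 h19 hq0.le hB2 hA hC hV2 hy
        calc 19 / 20 * δ = q ^ 2 * (19 / 20 * cubeDensity s A B C) := by rw [hδ]; ring
          _ ≤ _ := by gcongr)
      (by
        rw [← mul_expect, expect_comm B A, expect_comm B A]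
        exact hfE)
    have h2 : (#{y ∈ B | (𝔼 x ∈ A, f x y) < 9 / 10 * δ} : ℝ) * δ ≤ δ / 16 * #B * δ := by
      calc _ ≤ 20 * (1 / q ^ 17) * #B := h1
        _ ≤ δ ^ 2 / 16 * #B := by gcongr
        _ = _ := by ring
    exact le_of_mul_le_mul_right h2 hδ0
  have hbadC : (#{z ∈ C | (𝔼 x ∈ A, g x z) < 9 / 10 * δ} : ℝ) ≤ δ / 16 * #C := by
    have h1 := card_filter_lt_le hC (F := fun z => 𝔼 x ∈ A, g x z) (G := fun z => q ^ 2 * 𝔼 x ∈ A, 𝔼 y ∈ B, s x y z)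
      (δ := δ) (ε := 1 / q ^ 17)
      (fun z _ => by
        rw [mul_expect]
        exact expect_le_expect fun x _ => hgG x z)
      (fun z hz => by
        have := hmax.swap_right.slice_ge (fun _ _ _ => hs0 _ _ _) h19 hq0.le hC2 hA hB
          (by rw [cubeVolume_swap_right]; exact hV2) hz
        rw [cubeDensity_swap_right] at this
        calc 19 / 20 * δ = q ^ 2 * (19 / 20 * cubeDensity s A B C) := by rw [hδ]; ring
          _ ≤ _ := by gcongr)
      (by
        rw [← mul_expect, expect_comm C A, expect_comm C A]
        exact hgE)
    have h2 : (#{z ∈ C | (𝔼 x ∈ A, g x z) < 9 / 10 * δ} : ℝ) * δ ≤ δ / 16 * #C * δ := by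
      calc _ ≤ 20 * (1 / q ^ 17) * #C := h1
        _ ≤ δ ^ 2 / 16 * #C := by gcongr
        _ = _ := by ring
    exact le_of_mul_le_mul_right h2 hδ0
  have hhE' : 3 / 4 * δ ≤ 𝔼 y ∈ B, 𝔼 z ∈ C, h y z := by
    rw [hdens₃] at hhE
    have : δ ^ 2 ≤ 4 * δ := by rw [sq]; gcongr
    linarith
  have hinc : ∀ A' B' C' : Finset V, cubeVolume A B C ≤ 2 ^ (200 * d ^ 2) * cubeVolume A' B' C' →
      9 / 8 * δ ≤ q ^ 2 * cubeDensity s A' B' C' → False := by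
    intro A' B' C' h1 h2
    have h3 := hmax.not_increment hDpos hv0 hV hq0.le h1
    have h4 : q ^ 2 * (9 / 8 * cubeDensity s A B C) ≤ q ^ 2 * cubeDensity s A' B' C' := by
      linarith
    exact absurd (le_of_mul_le_mul_left h4 (by positivity)) (not_le.2 h3)
  rcases exists_increment_of_shadows hd (by linarith) hδ0 hδ4 hδ1 hδq hs0 hcyl hA hB hC
    (by rw [hδ]; field_simp) hf0 hf2 hfs hg0 hg2 hgs hh0 hh2 hhs hbadB hbadC hhE' with
    ⟨U, W, h1, h2⟩ | ⟨U, W, h1, h2⟩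
  · refine hinc U W C ?_ (h2.trans ?_)
    · unfold cubeVolume
      calc (#A : ℝ) * #B * #C ≤ 2 ^ (200 * d ^ 2) * (#U * #W) * #C := by gcongr
        _ = _ := by ring
    · simp_rw [cubeDensity, mul_expect U, mul_expect W]
      exact expect_le_expect fun x _ => expect_le_expect fun y _ => hfG x y
  · refine hinc U B W ?_ (h2.trans ?_)
    · unfold cubeVolume
      calc (#A : ℝ) * #B * #C = #A * #C * #B := by ring
        _ ≤ 2 ^ (200 * d ^ 2) * (#U * #W) * #B := by gcongr
        _ = _ := by ring
    · rw [← cubeDensity_swap_right]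
      simp_rw [cubeDensity, mul_expect U, mul_expect W]
      exact expect_le_expect fun x _ => expect_le_expect fun z _ => hgG x z

end CylinderIntersections

/-! ### The nondeterministic lower bound -/

section LowerBound

variable {F : Type*} [Field F] {k : ℕ}

theorem ipTriple_eq_true_iff {x y z : Fin k → F} : ipTriple F k x y z = true ↔ IpEq x y z := by
  simp [ipTriple, IpEq]

variable [Fintype F]

/-- A function `0 ≤ s ≤ 1` supported on the support of `ipTriple` has few heavy pairs. -/
theorem fewHeavyPairs_of_le (hk : 34 ≤ k) {s : (Fin k → F) → (Fin k → F) → (Fin k → F) → ℝ}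
    (hs1 : ∀ x y z, s x y z ≤ 1) (hs : ∀ x y z, s x y z ≠ 0 → IpEq x y z) :
    FewHeavyPairs (Fintype.card F : ℝ) s := by
  classical
  intro C hC
  have hcard : (Fintype.card (Fin k → F) : ℝ) = (Fintype.card F : ℝ) ^ k := by
    rw [Fintype.card_fun, Fintype.card_fin, Nat.cast_pow]
  rw [hcard] at hC ⊢
  refine ⟨_, card_heavy_pairs_le hk C hC, fun x y hxy => ?_⟩
  simp only [mem_filter, mem_univ, true_and, not_lt] at hxy
  have hq : (0 : ℝ) < Fintype.card F := by exact_mod_cast Fintype.card_pos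
  have hC0 : (0 : ℝ) < #C := by
    have h1 : (0 : ℝ) < Fintype.card F * #C := lt_of_lt_of_le (by positivity) hC
    exact pos_of_mul_pos_right h1 hq.le
  rw [expect_eq_sum_div_card, ← mul_div_assoc, div_le_iff₀ hC0]
  refine le_trans ?_ hxy
  gcongr
  rw [card_filter, Nat.cast_sum]
  refine sum_le_sum fun z _ => ?_
  by_cases h : s x y z = 0
  · rw [h]; positivity
  · rw [if_pos (hs x y z h), Nat.cast_one]
    exact hs1 x y z

/-- A nondeterministic protocol for `ipTriple` of cost `n` forces `|F| < 2 ^ (20000 (n + 1) ^ 3)`. -/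
theorem HasNondetNOF.card_lt (hk : 34 ≤ k) {n : ℕ} (h : HasNondetNOF (ipTriple F k) n) :
    (Fintype.card F : ℝ) < 2 ^ (20000 * (n + 1) ^ 3) := by
  classical
  obtain ⟨ι, _, a, b, c, hι, hcov⟩ := h.exists_cylinder_cover
  by_contra! hq
  have hq2 := two_le_card_field (F := F)
  have hqk : (Fintype.card F : ℝ) ^ 2 ≤ Fintype.card (Fin k → F) := by
    rw [Fintype.card_fun, Fintype.card_fin, Nat.cast_pow]
    exact pow_le_pow_right₀ (by linarith) (by omega)
  set q : ℝ := ((Fintype.card F : ℕ) : ℝ) with hqdef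
  let s : ι → (Fin k → F) → (Fin k → F) → (Fin k → F) → ℝ := fun i x y z =>
    if a i y z ∧ b i x z ∧ c i x y then 1 else 0
  have hsne : ∀ i x y z, s i x y z ≠ 0 → a i y z ∧ b i x z ∧ c i x y := fun i x y z h => by
    by_contra hcon
    exact h (if_neg hcon)
  have hs01 : ∀ i x y z, s i x y z = 0 ∨ s i x y z = 1 := fun i x y z => by
    by_cases hcon : a i y z ∧ b i x z ∧ c i x y
    · exact Or.inr (if_pos hcon)
    · exact Or.inl (if_neg hcon)
  have hs1 : ∀ i x y z, s i x y z ≤ 1 := fun i x y z => by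
    rcases hs01 i x y z with h | h <;> simp [h]
  have hsD : ∀ i x y z, s i x y z ≠ 0 → IpEq x y z := fun i x y z h =>
    ipTriple_eq_true_iff.1 ((hcov x y z).2 ⟨i, hsne i x y z h⟩)
  have hlt : ∀ i, q ^ 2 * cubeDensity (s i) univ univ univ < 1 / 2 ^ (n + 1) := fun i =>
    relative_density_lt (by omega) hq hqk (hs01 i)
      (fun x y z ⟨z', h1⟩ ⟨y', h2⟩ ⟨x', h3⟩ =>
        if_pos ⟨(hsne i _ _ _ h3).1, (hsne i _ _ _ h2).2.1, (hsne i _ _ _ h1).2.2⟩)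
      (fewHeavyPairs_of_le hk (hs1 i) (hsD i))
      (fewHeavyPairs_of_le hk (fun _ _ _ => hs1 i _ _ _) fun x z y h => (hsD i x y z h).swap_right)
      (fewHeavyPairs_of_le hk (fun _ _ _ => hs1 i _ _ _) fun y z x h =>
        (hsD i x y z h).swap_left.swap_right)
  -- The total density of the cover is at least that of the support of `ipTriple`.
  have htot : 1 / 2 ≤ ∑ i, q ^ 2 * cubeDensity (s i) univ univ univ := by
    have h1 := density_ipEq_ge (F := F) hk
    rw [← hqdef, div_le_iff₀ (by positivity)] at h1
    have h2 : ∑ x : Fin k → F, ∑ y : Fin k → F, (#{z : Fin k → F | IpEq x y z} : ℝ)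
        ≤ (q ^ k) ^ 3 * ∑ i, cubeDensity (s i) univ univ univ := by
      have h3 : ∀ i, (q ^ k) ^ 3 * cubeDensity (s i) univ univ univ
          = ∑ x, ∑ y, ∑ z, s i x y z := by
        intro i
        simp_rw [cubeDensity, expect_eq_sum_div_card, ← sum_div, card_univ, Fintype.card_fun,
          Fintype.card_fin, Nat.cast_pow]
        rw [← hqdef]
        have : q ^ k ≠ 0 := by positivity
        field_simp
      rw [mul_sum, sum_congr rfl fun i _ => h3 i, sum_comm (s := (univ : Finset ι))]
      refine sum_le_sum fun x _ => ?_
      rw [sum_comm (s := (univ : Finset ι))]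
      refine sum_le_sum fun y _ => ?_
      rw [sum_comm (s := (univ : Finset ι)), card_filter, Nat.cast_sum]
      refine sum_le_sum fun z _ => ?_
      have hnn : ∀ i ∈ (univ : Finset ι), 0 ≤ s i x y z := fun i _ => by
        rcases hs01 i x y z with h | h <;> simp [h]
      split_ifs with hD
      · obtain ⟨i, hi⟩ := (hcov x y z).1 (ipTriple_eq_true_iff.2 hD)
        have h4 : s i x y z = 1 := if_pos hi
        rw [Nat.cast_one, ← h4]
        exact single_le_sum hnn (mem_univ i)
      · rw [Nat.cast_zero]
        exact sum_nonneg hnn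
    rw [← mul_sum]
    have h5 : (q ^ k) ^ 3 ≤ (q ^ k) ^ 3 *
        (2 * (q ^ 2 * ∑ i, cubeDensity (s i) univ univ univ)) := by
      calc (q ^ k) ^ 3 ≤ _ := h1
        _ ≤ ((q ^ k) ^ 3 * ∑ i, cubeDensity (s i) univ univ univ) * (2 * q ^ 2) := by gcongr
        _ = _ := by ring
    have h6 := le_of_mul_le_mul_left ((mul_one ((q ^ k) ^ 3)).trans_le h5) (by positivity)
    linarith
  have hne : Nonempty ι := by
    by_contra hcon
    rw [not_nonempty_iff] at hcon
    rw [univ_eq_empty, sum_empty] at htot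
    norm_num at htot
  have hlt' : ∑ i, q ^ 2 * cubeDensity (s i) univ univ univ < ∑ _i : ι, 1 / 2 ^ (n + 1) :=
    sum_lt_sum_of_nonempty univ_nonempty fun i _ => hlt i
  rw [sum_const, card_univ, nsmul_eq_mul] at hlt'
  have hι' : (Fintype.card ι : ℝ) ≤ 2 ^ n := by exact_mod_cast hι
  have h7 : (Fintype.card ι : ℝ) * (1 / 2 ^ (n + 1)) ≤ 2 ^ n * (1 / 2 ^ (n + 1)) := by gcongr
  have h8 : (2 : ℝ) ^ n * (1 / 2 ^ (n + 1)) = 1 / 2 := by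
    rw [pow_succ]
    field_simp
  linarith

/-- The bound `|F| < 2 ^ (20000 (n + 1) ^ 3)` solved for `n`, using `n + 1 ≤ 2 n`. -/
theorem HasNondetNOF.le_cost (hk : 34 ≤ k) {n : ℕ} (h : HasNondetNOF (ipTriple F k) n) :
    (1 / (160000 * k) : ℝ) ^ (1 / 3 : ℝ) *
      (Real.logb 2 ((Fintype.card F ^ k : ℕ) : ℝ)) ^ (1 / 3 : ℝ) ≤ n := by
  have hn := h.one_le_of_ipTriple (by omega)
  have hlt := h.card_lt hk
  have hq2 := two_le_card_field (F := F)
  have hk0 : (0 : ℝ) < k := by exact_mod_cast (by omega : 0 < k)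
  have hn1 : (1 : ℝ) ≤ n := by exact_mod_cast hn
  have hlog0 : 0 ≤ Real.logb 2 (Fintype.card F : ℝ) :=
    Real.logb_nonneg one_lt_two (by linarith)
  have hlog : Real.logb 2 (Fintype.card F : ℝ) ≤ 160000 * (n : ℝ) ^ 3 := by
    have h1 : Real.logb 2 (Fintype.card F : ℝ) ≤ ((20000 * (n + 1) ^ 3 : ℕ) : ℝ) := by
      rw [Real.logb_le_iff_le_rpow one_lt_two (by linarith), Real.rpow_natCast]
      exact hlt.le
    refine h1.trans ?_
    push_cast
    have h2 : ((n : ℝ) + 1) ^ 3 ≤ (2 * n) ^ 3 := by gcongr; linarith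
    linarith
  rw [Nat.cast_pow, Real.logb_pow, ← Real.mul_rpow (by positivity) (by positivity)]
  have h3 : 1 / (160000 * (k : ℝ)) * (k * Real.logb 2 (Fintype.card F : ℝ)) ≤ (n : ℝ) ^ 3 := by
    rw [one_div, inv_mul_le_iff₀ (by positivity)]
    calc _ ≤ (k : ℝ) * (160000 * (n : ℝ) ^ 3) := by gcongr
      _ = _ := by ring
  calc _ ≤ ((n : ℝ) ^ 3) ^ (1 / 3 : ℝ) := by gcongr
    _ = n := by
      rw [← Real.rpow_natCast, ← Real.rpow_mul (by positivity)]
      norm_num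

end LowerBound

theorem ofReal_le_toENNReal_iInf {P : ℕ → Prop} {x : ℝ} (h : ∀ n, P n → x ≤ n) :
    ENNReal.ofReal x ≤ ((⨅ (n : ℕ) (_ : P n), (n : ℕ∞) : ℕ∞) : ENNReal) := by
  have h1 : ((⌈x⌉₊ : ℕ) : ℕ∞) ≤ ⨅ (n : ℕ) (_ : P n), (n : ℕ∞) :=
    le_iInf₂ fun n hn => Nat.cast_le.2 (Nat.ceil_le.2 (h n hn))
  calc ENNReal.ofReal x ≤ ((⌈x⌉₊ : ℕ) : ENNReal) := by
        rw [← ENNReal.ofReal_natCast]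
        exact ENNReal.ofReal_le_ofReal (Nat.le_ceil x)
    _ = (((⌈x⌉₊ : ℕ) : ℕ∞) : ENNReal) := by simp
    _ ≤ _ := ENat.toENNReal_le.2 h1

theorem theorem1 :
    ∃ C : ℕ, ∀ k : ℕ, 34 ≤ k → ∃ c : ℝ, 0 < c ∧
      ∀ q : ℕ, IsPrimePow q →
        ∀ (F : Type*) [Field F] [Fintype F], Fintype.card F = q →
          ∀ N : ℕ, N = q ^ k →
            randNOF (ipTriple F k) ≤ (C : ℕ∞) ∧
            ENNReal.ofReal (c * (Real.logb 2 (N : ℝ)) ^ (1 / 3 : ℝ))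
              ≤ (detNOF (ipTriple F k) : ENNReal) ∧
            ENNReal.ofReal (c * (Real.logb 2 (N : ℝ)) ^ (1 / 3 : ℝ))
              ≤ (nondetNOF (ipTriple F k) : ENNReal) := by
  refine ⟨4, fun k hk => ⟨(1 / (160000 * k) : ℝ) ^ (1 / 3 : ℝ), ?_, ?_⟩⟩
  · have hk0 : (0 : ℝ) < k := by exact_mod_cast (by omega : 0 < k)
    positivity
  · rintro q - F _ _ rfl N rfl
    refine ⟨iInf₂_le 4 (hasRandNOF_ipTriple F k), ?_, ?_⟩
    · exact ofReal_le_toENNReal_iInf fun n hn => hn.hasNondetNOF.le_cost hk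
    · exact ofReal_le_toENNReal_iInf fun n hn => hn.le_cost hk
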